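/- Let $0<\alpha<2$ and let $(S_1,\mu_1)$, $(S_2,\mu_2)$ be $\sigma$-finite measure spaces. Write $L^\alpha_+(S,\mu)=\{f\in L^\alpha(S,\mu): f\ge 0\}$ and, for $f,g\in L^\alpha_+(S,\mu)$, $\rho_{\mu,\alpha}(f,g)=\int_S|f^\alpha-g^\alpha|\,d\mu$. A set $\mathcal F\subset L^\alpha_+(S,\mu)$ is a *positive-linear* (respectively *max-linear*) *subspace* if it is closed in $L^\alpha_+(S,\mu)$ with respect to $\rho_{\mu,\alpha}$ and contains $\sum_{i=1}^n a_if_i$ (respectively $\bigvee_{i=1}^n a_if_i$) for all $n\ge 1$, $f_i\in\mathcal F$, $a_i>0$. For a set $F\subset L^\alpha(S,\mu)$ let $\rho(F)$ be the $\sigma$-field generated by the ratios $f_1/f_2$ of all measurable representatives of elements of $F$, with values in $[-\infty,\infty]$ and $0/0=0$. Put $$\mathcal R_e(F)=\{rf\in L^\alpha(S,\mu): r\ \rho(F)\text{-measurable},\ f\in F\},$$ $$\mathcal R_{e,+}(F)=\{rf\in L^\alpha_+(S,\mu): r\ge 0\ \ \rho(F)\text{-measurable},\ f\in F\}.$$ A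 map $V$ on a linear or positive-linear subspace $E$ is a *linear isometry* if $V(af+bg)=aVf+bVg$ whenever $f,g,af+bg\in E$, $a,b\in\mathbb R$, and $\|Vf-Vg\|_{L^\alpha}=\|f-g\|_{L^\alpha}$ for $f,g\in E$. It is a *positive-linear isometry* if moreover $Vf\ge 0$ for every $f\in E$ with $f\ge 0$. A map $V$ from a max-linear subspace $E$ into $L^\alpha_+$ is a *max-linear isometry* if $V(af\vee bg)=aVf\vee bVg$ for $f,g\in E$, $a,b\ge 0$, and $\|Vf\|_{L^\alpha}=\|f\|_{L^\alpha}$ for $f\in E$. 1. Let $\mathcal F$ be a positive-linear subspace of $L^\alpha_+(S_1,\mu_1)$ and let $U:\mathcal F\to L^\alpha_+(S_2,\mu_2)$ be a positive-linear isometry. Then $U$ extends uniquely to a linear isometry $\overline U:\mathcal R_e(\mathcal F)\to\mathcal R_e(U(\mathcal F))$, and $\overline U$ is also a max-linear isometry from $\mathcal R_{e,+}(\mathcal F)$ to $\mathcal R_{e,+}(U(\mathcal F))$. 2. Let $\mathcal F$ be a max-linear subspace of $L^\alpha_+(S_1,\mu_1)$ and let $U:\mathcal F\to L^\alpha_+(S_2,\mu_2)$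 be a max-linear isometry. Then $U$ extends uniquely to a max-linear isometry $\overline U:\mathcal R_{e,+}(\mathcal F)\to\mathcal R_{e,+}(U(\mathcal F))$, and $\overline U$ is also, when extended linearly to $\mathcal R_e(\mathcal F)$, a positive-linear isometry from $\mathcal R_e(\mathcal F)$ to $\mathcal R_e(U(\mathcal F))$. -/

import Mathlib

open MeasureTheory Set Filter Topology

noncomputable section

/-- The space `L^α(S, μ)` of real functions modulo `μ`-a.e. equality.  For `0 < α < ∞` the
norm symbol denotes `‖f‖ = (∫ |f|^α dμ)^(1/α)`, also for `α < 1`; order and lattice operations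
are the pointwise a.e. ones. -/
abbrev LAlpha {S : Type*} [MeasurableSpace S] (α : ℝ) (μ : Measure S) : Type _ :=
  Lp ℝ (ENNReal.ofReal α) μ

namespace LAlpha

variable {S S₁ S₂ : Type*} [MeasurableSpace S] [MeasurableSpace S₁] [MeasurableSpace S₂]

/-- The metric `ρ_{μ,α}(f, g) = ∫ |f^α - g^α| dμ` on the nonnegative functions of `L^α`. -/
def rho (α : ℝ) (μ : Measure S) (f g : LAlpha α μ) : ℝ :=
  ∫ s, |(f s) ^ α - (g s) ^ α| ∂μ

/-- `F`, a set of nonnegative functions, is closed in `L^α_+` for the metric `ρ_{μ,α}`. -/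
def IsRhoClosed (α : ℝ) (μ : Measure S) (F : Set (LAlpha α μ)) : Prop :=
  ∀ (u : ℕ → LAlpha α μ) (f : LAlpha α μ), (∀ n, u n ∈ F) → 0 ≤ f →
    Tendsto (fun n => rho α μ (u n) f) atTop (𝓝 0) → f ∈ F

/-- Positive-linear subspace of `L^α_+`: nonnegative functions, closed under linear combinations
with positive coefficients (two terms suffice, by induction) and `ρ`-closed. -/
structure IsPositiveLinearSpace (α : ℝ) (μ : Measure S) (F : Set (LAlpha α μ)) : Prop where
  nonneg : ∀ f ∈ F, 0 ≤ f
  add_mem : ∀ f ∈ F, ∀ g ∈ F, ∀ a b : ℝ, 0 < a → 0 < b → a • f + b • g ∈ F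
  closed : IsRhoClosed α μ F

/-- Max-linear subspace of `L^α_+`: nonnegative functions, closed under max-linear combinations
with positive coefficients (two terms suffice, by induction) and `ρ`-closed. -/
structure IsMaxLinearSpace (α : ℝ) (μ : Measure S) (F : Set (LAlpha α μ)) : Prop where
  nonneg : ∀ f ∈ F, 0 ≤ f
  sup_mem : ∀ f ∈ F, ∀ g ∈ F, ∀ a b : ℝ, 0 < a → 0 < b → (a • f) ⊔ (b • g) ∈ F
  closed : IsRhoClosed α μ F

/-- The ratio `a / b` in `[-∞, ∞]`, with `a / 0 = ±∞` according to the sign of `a`, and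
`0 / 0 = 0`. -/
def extRatio (a b : ℝ) : EReal :=
  if b = 0 then (if 0 < a then ⊤ else if a < 0 then ⊥ else 0) else ((a / b : ℝ) : EReal)

/-- The ratio `σ`-field of `F`: generated by the ratios of all (measurable representatives of)
functions in `F`. -/
@[reducible] def ratioSigma {α : ℝ} {μ : Measure S} (F : Set (LAlpha α μ)) : MeasurableSpace S :=
  MeasurableSpace.generateFrom
    {A | ∃ u v : S → ℝ, Measurable u ∧ Measurable v ∧
      (∃ f ∈ F, u =ᵐ[μ] f) ∧ (∃ g ∈ F, v =ᵐ[μ] g) ∧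
      ∃ B : Set EReal, MeasurableSet B ∧ A = (fun s => extRatio (u s) (v s)) ⁻¹' B}

/-- The extended ratio space: all functions in `L^α` of the form `r f` with `f ∈ F` and `r`
measurable for the ratio `σ`-field. -/
def extendedRatioSpace {α : ℝ} {μ : Measure S} (F : Set (LAlpha α μ)) : Set (LAlpha α μ) :=
  {h | ∃ r : S → ℝ, Measurable[ratioSigma F] r ∧ ∃ f ∈ F, h =ᵐ[μ] fun s => r s * f s}

/-- The extended positive ratio space: all functions in `L^α_+` of the form `r f` with `f ∈ F`
and `r ≥ 0` measurable for the ratio `σ`-field. -/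
def extendedPosRatioSpace {α : ℝ} {μ : Measure S} (F : Set (LAlpha α μ)) : Set (LAlpha α μ) :=
  {h | 0 ≤ h ∧ ∃ r : S → ℝ, Measurable[ratioSigma F] r ∧ (∀ s, 0 ≤ r s) ∧
    ∃ f ∈ F, h =ᵐ[μ] fun s => r s * f s}

variable {α : ℝ} {μ₁ : Measure S₁} {μ₂ : Measure S₂}

/-- `V` is a linear isometry on `E`, where `E` is a linear subspace of `L^α` or a positive-linear
one: `V` respects the real linear combinations that stay in `E` and satisfies
`‖V f - V g‖ = ‖f - g‖`. Values of `V` outside `E` are irrelevant. -/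
structure IsLinearIsometryOn (V : LAlpha α μ₁ → LAlpha α μ₂) (E : Set (LAlpha α μ₁)) :
    Prop where
  map_comb : ∀ f ∈ E, ∀ g ∈ E, ∀ a b : ℝ, a • f + b • g ∈ E →
    V (a • f + b • g) = a • V f + b • V g
  isometry : ∀ f ∈ E, ∀ g ∈ E, ‖V f - V g‖ = ‖f - g‖

/-- A positive-linear isometry: a linear isometry mapping nonnegative functions to nonnegative
functions. -/
structure IsPositiveLinearIsometryOn (V : LAlpha α μ₁ → LAlpha α μ₂)
    (E : Set (LAlpha α μ₁)) : Prop extends IsLinearIsometryOn V E where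
  map_nonneg : ∀ f ∈ E, 0 ≤ f → 0 ≤ V f

/-- A max-linear isometry from `E`, a max-linear subspace of `L^α_+`, to `L^α_+`. -/
structure IsMaxLinearIsometryOn (V : LAlpha α μ₁ → LAlpha α μ₂) (E : Set (LAlpha α μ₁)) :
    Prop where
  nonneg : ∀ f ∈ E, 0 ≤ V f
  map_sup : ∀ f ∈ E, ∀ g ∈ E, ∀ a b : ℝ, 0 ≤ a → 0 ≤ b →
    V ((a • f) ⊔ (b • g)) = (a • V f) ⊔ (b • V g)
  norm_map : ∀ f ∈ E, ‖V f‖ = ‖f‖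

/-- `V` restricts to a linear isometry from the extended ratio space of `F` to that of `U(F)`,
extending `U`. -/
structure IsLinearExtension (F : Set (LAlpha α μ₁)) (U V : LAlpha α μ₁ → LAlpha α μ₂) :
    Prop where
  isom : IsLinearIsometryOn V (extendedRatioSpace F)
  mapsTo : MapsTo V (extendedRatioSpace F) (extendedRatioSpace (U '' F))
  eqOn : EqOn V U F

/-- `V` restricts to a max-linear isometry from the extended positive ratio space of `F` to that
of `U(F)`, extending `U`. -/
structure IsMaxLinearExtension (F : Set (LAlpha α μ₁)) (U V : LAlpha α μ₁ → LAlpha α μ₂) :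
    Prop where
  isom : IsMaxLinearIsometryOn V (extendedPosRatioSpace F)
  mapsTo : MapsTo V (extendedPosRatioSpace F) (extendedPosRatioSpace (U '' F))
  eqOn : EqOn V U F

end LAlpha

end

noncomputable section

namespace LAlpha

variable {S S₁ S₂ : Type*} [MeasurableSpace S] [MeasurableSpace S₁] [MeasurableSpace S₂]
  {α : ℝ} {μ : Measure S} {μ₁ : Measure S₁} {μ₂ : Measure S₂} {ι : Type*}

/-! ### Measures on the line and their `α`-th absolute moments -/

/-! Everything is read off from one finite measure. Since `μ₁` is σ-finite and `F` is closed, a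
nonempty `F` contains some `f₀` off whose support every member vanishes (`exists_full_support`). Let
`ratioLaw` be the joint law of all ratios `f / f₀`, `f ∈ F`, under `|f₀|^α dμ`. The extended ratio
space consists exactly of the functions `φ(ratios) f₀` in `L^α` with `φ` measurable
(`mem_extendedRatioSpace_range_iff`), and the norm of such a function is the `L^α` norm of `φ` under
the ratio law (`eLpNorm_comp_ratios`).

Hence, once `(f)` and `(U f)` have the same ratio law, sending `φ(f / f₀) f₀` to `φ(U f / U f₀) U
f₀` is well defined and isometric. It respects linear combinations and, because `f₀` and `U f₀` are
nonnegative, also maxima. So linear and max-linear isometries have the same extension, and both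
halves reduce to the equality of two laws.

Linear case (`ratioLaw_eq_of_norm_linearCombination`): the norms `‖h + b f₀‖`, `b` real, give the
integrals of `|x + b|^α` against the law of `h / f₀`, up to a constant. For `0 < α < 2` the second
difference of `|x|^α` is a multiple of the Fourier transform of a finite measure with a.e. positive
density, so these integrals determine the law (`ext_of_integral_abs_add_rpow`); the Cramér–Wold
device then gives the joint law.

Max-linear case (`ratioLaw_eq_of_max`): the left derivative of `‖h ⊔ t f₀‖^α` in `t^α` at `t = 1` is
the weight of `{h < f₀}`. With `h` the maximum of the `f i / c i`, this is the mass of the box `f i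
/ f₀ < c i`. No upper bound on `α` enters here.

Uniqueness applies the same principle to the family enlarged by one element `h` of the extended
space (`Corr.eq_of_option`): as `h` is a function of the old ratios times `f₀`, any extension must
send it to the same function of the new ratios times `U f₀`. -/

lemma integrable_one_sub_cos_mul_rpow {α : ℝ} (hα : 0 < α) (hα2 : α < 2) :
    Integrable (fun t : ℝ => (1 - Real.cos t) * |t| ^ (-1 - α)) := by
  have hmeas : Measurable (fun t : ℝ => (1 - Real.cos t) * t ^ (-1 - α)) := by fun_prop
  have key : IntegrableOn (fun t : ℝ => (1 - Real.cos t) * t ^ (-1 - α)) (Ioi 0) := by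
    rw [← Ioc_union_Ioi_eq_Ioi zero_le_one]
    -- On `(0, 1]` the integrand is at most `t^(1-α)`, integrable as `α < 2`; on `(1, ∞)` it is at
    -- most `2 t^(-1-α)`, integrable as `α > 0`.
    refine IntegrableOn.union ?_ ?_
    · have h := (intervalIntegral.intervalIntegrable_rpow' (a := 0) (b := 1) (r := 1 - α)
        (by linarith)).1
      refine Integrable.mono' h hmeas.aestronglyMeasurable ?_
      filter_upwards [ae_restrict_mem measurableSet_Ioc] with t ht
      have h0 : 0 ≤ 1 - Real.cos t := by linarith [Real.cos_le_one t]
      have h1 : 1 - Real.cos t ≤ t ^ (2 : ℝ) := by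
        have := Real.one_sub_sq_div_two_le_cos (x := t)
        rw [Real.rpow_two]; nlinarith [sq_nonneg t]
      rw [Real.norm_of_nonneg (mul_nonneg h0 (Real.rpow_nonneg ht.1.le _))]
      calc _ ≤ t ^ (2 : ℝ) * t ^ (-1 - α) :=
            mul_le_mul_of_nonneg_right h1 (Real.rpow_nonneg ht.1.le _)
        _ = _ := by rw [← Real.rpow_add ht.1]; ring_nf
    · have h := (integrableOn_Ioi_rpow_of_lt (a := -1 - α) (by linarith)
        (zero_lt_one (α := ℝ))).const_mul 2
      refine Integrable.mono' h hmeas.aestronglyMeasurable ?_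
      filter_upwards [ae_restrict_mem measurableSet_Ioi] with t ht
      have ht0 : (0 : ℝ) < t := lt_trans zero_lt_one ht
      rw [Real.norm_of_nonneg (mul_nonneg (by linarith [Real.cos_le_one t])
        (Real.rpow_nonneg ht0.le _))]
      exact mul_le_mul_of_nonneg_right (by linarith [Real.neg_one_le_cos t])
        (Real.rpow_nonneg ht0.le _)
  have hpos : IntegrableOn (fun t : ℝ => (1 - Real.cos t) * |t| ^ (-1 - α)) (Ioi 0) :=
    key.congr_fun (fun t ht => by simp only [abs_of_pos (mem_Ioi.1 ht)]) measurableSet_Ioi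
  have hneg : IntegrableOn (fun t : ℝ => (1 - Real.cos t) * |t| ^ (-1 - α)) (Iio 0) := by
    rw [← neg_zero] at hpos
    simpa only [Real.cos_neg, abs_neg] using hpos.comp_neg_Iio
  rw [← integrableOn_univ, ← Iic_union_Ioi (a := (0 : ℝ))]
  exact ((integrableOn_Iic_iff_integrableOn_Iio (by simp)).2 hneg).union hpos

/-- The constant `∫ (1 - cos t) |t|^(-1-α) dt`. -/
def cosConst (α : ℝ) : ℝ := ∫ t : ℝ, (1 - Real.cos t) * |t| ^ (-1 - α)

lemma one_sub_cos_mul_scale {α : ℝ} {x : ℝ} (hx : x ≠ 0) (t : ℝ) :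
    (1 - Real.cos (x * t)) * |t| ^ (-1 - α)
      = |x| ^ (1 + α) * ((1 - Real.cos (x * t)) * |x * t| ^ (-1 - α)) := by
  rw [abs_mul, Real.mul_rpow (abs_nonneg _) (abs_nonneg _)]
  have : |x| ^ (1 + α) * |x| ^ (-1 - α) = 1 := by
    rw [← Real.rpow_add (abs_pos.2 hx)]; simp
  calc _ = (|x| ^ (1 + α) * |x| ^ (-1 - α)) * ((1 - Real.cos (x * t)) * |t| ^ (-1 - α)) := by
        rw [this, one_mul]
    _ = _ := by ring

lemma integrable_one_sub_cos_scale {α : ℝ} (hα : 0 < α) (hα2 : α < 2) (x : ℝ) :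
    Integrable (fun t : ℝ => (1 - Real.cos (x * t)) * |t| ^ (-1 - α)) := by
  rcases eq_or_ne x 0 with rfl | hx
  · simp
  · simp_rw [one_sub_cos_mul_scale (α := α) hx]
    exact ((integrable_one_sub_cos_mul_rpow hα hα2).comp_mul_left' hx).const_mul _

lemma integral_one_sub_cos_scale {α : ℝ} (hα : 0 < α) (x : ℝ) :
    ∫ t : ℝ, (1 - Real.cos (x * t)) * |t| ^ (-1 - α) = |x| ^ α * cosConst α := by
  rcases eq_or_ne x 0 with rfl | hx
  · simp [Real.zero_rpow hα.ne']
  · simp_rw [one_sub_cos_mul_scale (α := α) hx]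
    rw [integral_const_mul,
      Measure.integral_comp_mul_left (fun t => (1 - Real.cos t) * |t| ^ (-1 - α)) x,
      smul_eq_mul, ← mul_assoc, abs_inv, cosConst]
    congr 1
    rw [Real.rpow_add (abs_pos.2 hx), Real.rpow_one]
    field_simp [abs_ne_zero.2 hx]

/-- The finite measure `2 (1 - cos t) |t|^(-1-α) dt`. -/
def cosMeasure (α : ℝ) : Measure ℝ :=
  volume.withDensity fun t => ENNReal.ofReal (2 * ((1 - Real.cos t) * |t| ^ (-1 - α)))

lemma isFiniteMeasure_cosMeasure {α : ℝ} (hα : 0 < α) (hα2 : α < 2) :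
    IsFiniteMeasure (cosMeasure α) :=
  isFiniteMeasure_withDensity_ofReal
    ((integrable_one_sub_cos_mul_rpow hα hα2).const_mul 2).2

lemma cosMeasure_density_nonneg (α t : ℝ) : 0 ≤ 2 * ((1 - Real.cos t) * |t| ^ (-1 - α)) :=
  mul_nonneg zero_le_two (mul_nonneg (by linarith [Real.cos_le_one t])
    (Real.rpow_nonneg (abs_nonneg _) _))

lemma integral_cosMeasure {E : Type*} [NormedAddCommGroup E] [NormedSpace ℝ E] (α : ℝ)
    (f : ℝ → E) :
    ∫ t, f t ∂(cosMeasure α) = ∫ t, (2 * ((1 - Real.cos t) * |t| ^ (-1 - α))) • f t := by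
  rw [cosMeasure, integral_withDensity_eq_integral_toReal_smul (by fun_prop)
    (ae_of_all _ fun _ => ENNReal.ofReal_lt_top)]
  simp_rw [ENNReal.toReal_ofReal (cosMeasure_density_nonneg α _)]

/-- The product `2 (1 - cos t) cos (x t)` is the second difference in `x` of `1 - cos (x t)`, whose
integral scales like `|x|^α`. The sine part vanishes by oddness. -/
lemma charFun_cosMeasure {α : ℝ} (hα : 0 < α) (hα2 : α < 2) (x : ℝ) :
    charFun (cosMeasure α) x
      = (((|x + 1| ^ α + |x - 1| ^ α - 2 * |x| ^ α) * cosConst α : ℝ) : ℂ) := by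
  have := isFiniteMeasure_cosMeasure hα hα2
  have hint : Integrable (fun t : ℝ => Complex.exp (x * t * Complex.I)) (cosMeasure α) := by
    refine Integrable.of_bound (C := 1) (by fun_prop) (ae_of_all _ fun t => ?_)
    rw [← Complex.ofReal_mul, Complex.norm_exp_ofReal_mul_I]
  rw [charFun_apply_real]
  apply Complex.ext
  · have : (∫ t, Complex.exp (x * t * Complex.I) ∂(cosMeasure α)).re
        = ∫ t, Real.cos (x * t) ∂(cosMeasure α) := by
      rw [← RCLike.re_eq_complex_re, ← integral_re hint]
      congr with t
      rw [RCLike.re_eq_complex_re, ← Complex.ofReal_mul, Complex.exp_ofReal_mul_I_re]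
    rw [this, integral_cosMeasure, Complex.ofReal_re]
    have e : ∀ t : ℝ, (2 * ((1 - Real.cos t) * |t| ^ (-1 - α))) • Real.cos (x * t)
        = ((1 - Real.cos ((x + 1) * t)) * |t| ^ (-1 - α)
          + (1 - Real.cos ((x - 1) * t)) * |t| ^ (-1 - α))
          - 2 * ((1 - Real.cos (x * t)) * |t| ^ (-1 - α)) := by
      intro t
      rw [add_mul x, sub_mul x, one_mul, Real.cos_add, Real.cos_sub, smul_eq_mul]
      ring
    simp_rw [e]
    have i := integrable_one_sub_cos_scale hα hα2
    rw [integral_sub (by exact (i _).add (i _)) ((i _).const_mul 2), integral_add (i _) (i _),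
      integral_const_mul]
    simp_rw [integral_one_sub_cos_scale hα]
    ring
  · have : (∫ t, Complex.exp (x * t * Complex.I) ∂(cosMeasure α)).im
        = ∫ t, Real.sin (x * t) ∂(cosMeasure α) := by
      rw [← RCLike.im_eq_complex_im, ← integral_im hint]
      congr with t
      rw [RCLike.im_eq_complex_im, ← Complex.ofReal_mul, Complex.exp_ofReal_mul_I_im]
    rw [this, integral_cosMeasure, Complex.ofReal_im]
    have h := integral_neg_eq_self
      (fun t : ℝ => (2 * ((1 - Real.cos t) * |t| ^ (-1 - α))) • Real.sin (x * t)) volume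
    simp only [abs_neg, Real.cos_neg, mul_neg, Real.sin_neg, smul_neg, integral_neg] at h
    linarith

lemma continuous_charFun_real (ν : Measure ℝ) [IsFiniteMeasure ν] : Continuous (charFun ν) := by
  simp_rw [funext fun t => charFun_apply_real (μ := ν) t]
  refine continuous_of_dominated (bound := fun _ => 1) (fun t => by fun_prop) (fun t => ?_)
    (integrable_const _) (ae_of_all _ fun x => by fun_prop)
  refine ae_of_all _ fun x => ?_
  rw [← Complex.ofReal_mul, Complex.norm_exp_ofReal_mul_I]

/-- A real function whose Fourier transform with respect to `P` vanishes is zero. -/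
lemma ae_eq_zero_of_fourier_real {P : Measure ℝ} {q : ℝ → ℝ} (hq : Integrable q P)
    (hm : Measurable q)
    (h : ∀ b : ℝ, ∫ t, Complex.exp (b * t * Complex.I) * (q t : ℂ) ∂P = 0) : q =ᵐ[P] 0 := by
  have f1 : IsFiniteMeasure (P.withDensity fun t => ENNReal.ofReal (q t)) :=
    isFiniteMeasure_withDensity_ofReal hq.2
  have f2 : IsFiniteMeasure (P.withDensity fun t => ENNReal.ofReal (-q t)) :=
    isFiniteMeasure_withDensity_ofReal hq.neg.2
  -- The positive and negative parts of `q` define finite measures whose characteristic functions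
  -- differ by the transform of `q`, which is zero.
  have key : P.withDensity (fun t => ENNReal.ofReal (q t))
      = P.withDensity fun t => ENNReal.ofReal (-q t) := by
    refine Measure.ext_of_charFun (funext fun b => ?_)
    rw [charFun_apply_real, charFun_apply_real,
      integral_withDensity_eq_integral_toReal_smul (by fun_prop) (by simp),
      integral_withDensity_eq_integral_toReal_smul (by fun_prop) (by simp), ← sub_eq_zero,
      ← integral_sub]
    · rw [← h b]
      congr with t
      rw [← sub_smul, ENNReal.toReal_ofReal',
        ENNReal.toReal_ofReal', Complex.real_smul, mul_comm]
      congr 2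
      rcases le_total 0 (q t) with h0 | h0
      · rw [max_eq_left h0, max_eq_right (by linarith), sub_zero]
      · rw [max_eq_right h0, max_eq_left (by linarith)]; ring
    all_goals
      simp_rw [ENNReal.toReal_ofReal']
      refine Integrable.mono' hq.norm (by fun_prop) (ae_of_all _ fun t => ?_)
      rw [norm_smul, ← Complex.ofReal_mul, Complex.norm_exp_ofReal_mul_I, mul_one,
        Real.norm_eq_abs, Real.norm_eq_abs, abs_of_nonneg (le_max_right _ _)]
      simp [le_abs_self, neg_le_abs]
  have e := (withDensity_eq_iff (by fun_prop) (by fun_prop) (by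
    simpa [withDensity_apply _ MeasurableSet.univ] using
      measure_ne_top (P.withDensity fun t => ENNReal.ofReal (q t)) univ)).1 key
  filter_upwards [e] with t ht
  have := congrArg ENNReal.toReal ht
  rw [ENNReal.toReal_ofReal', ENNReal.toReal_ofReal'] at this
  rcases le_total 0 (q t) with h0 | h0
  · rw [max_eq_left h0, max_eq_right (by linarith)] at this; exact this
  · rw [max_eq_right h0, max_eq_left (by linarith)] at this; simpa using this.symm

/-- Conjugating the hypothesis at `-b` shows that the conjugate of `q` also has vanishing transform;
hence so do the real and imaginary parts, and the real case applies. -/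
lemma ae_eq_zero_of_fourier {P : Measure ℝ} {q : ℝ → ℂ} (hq : Integrable q P)
    (hm : Measurable q)
    (h : ∀ b : ℝ, ∫ t, Complex.exp (b * t * Complex.I) * q t ∂P = 0) : q =ᵐ[P] 0 := by
  have hc : ∀ b : ℝ, ∫ t, Complex.exp (b * t * Complex.I) * (starRingEnd ℂ) (q t) ∂P = 0 := by
    intro b
    have := congrArg (starRingEnd ℂ) (h (-b))
    rw [← integral_conj, map_zero] at this
    rw [← this]
    congr with t
    rw [map_mul, ← Complex.exp_conj]
    simp
  have hi : ∀ b : ℝ, Integrable (fun t : ℝ => Complex.exp (b * t * Complex.I) * q t) P :=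
    fun b => hq.bdd_mul (c := 1) (by fun_prop) (ae_of_all _ fun t => by
      rw [← Complex.ofReal_mul, Complex.norm_exp_ofReal_mul_I])
  have hic : ∀ b : ℝ, Integrable
      (fun t : ℝ => Complex.exp (b * t * Complex.I) * (starRingEnd ℂ) (q t)) P :=
    fun b => (Complex.conjCLE.toContinuousLinearMap.integrable_comp hq).bdd_mul (c := 1)
      (by fun_prop) (ae_of_all _ fun t => by
        rw [← Complex.ofReal_mul, Complex.norm_exp_ofReal_mul_I])
  have hre := ae_eq_zero_of_fourier_real (q := fun t => (q t).re) hq.re (by fun_prop) fun b => by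
    have e : ∀ t : ℝ, Complex.exp (b * t * Complex.I) * ((q t).re : ℂ)
        = 2⁻¹ * (Complex.exp (b * t * Complex.I) * q t
          + Complex.exp (b * t * Complex.I) * (starRingEnd ℂ) (q t)) := fun t => by
      rw [Complex.re_eq_add_conj]; ring
    simp_rw [e]
    rw [integral_const_mul, integral_add (hi b) (hic b), h, hc]; simp
  have him := ae_eq_zero_of_fourier_real (q := fun t => (q t).im) hq.im (by fun_prop) fun b => by
    have e : ∀ t : ℝ, Complex.exp (b * t * Complex.I) * ((q t).im : ℂ)
        = (2 * Complex.I)⁻¹ * (Complex.exp (b * t * Complex.I) * q t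
          - Complex.exp (b * t * Complex.I) * (starRingEnd ℂ) (q t)) := fun t => by
      rw [Complex.im_eq_sub_conj]; ring
    simp_rw [e]
    rw [integral_const_mul, integral_sub (hi b) (hic b), h, hc]; simp
  filter_upwards [hre, him] with t h1 h2
  exact Complex.ext h1 h2

/-- The density is positive wherever `cos t ≠ 1`, that is, off a countable set. -/
lemma volume_absolutelyContinuous_cosMeasure (α : ℝ) : (volume : Measure ℝ) ≪ cosMeasure α := by
  refine withDensity_absolutelyContinuous' (by fun_prop) ?_
  have hc : {t : ℝ | Real.cos t = 1}.Countable := by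
    refine (countable_range (fun n : ℤ => (n : ℝ) * (2 * Real.pi))).mono ?_
    intro t ht
    exact (Real.cos_eq_one_iff t).1 ht
  filter_upwards [hc.ae_notMem volume] with t ht
  have h1 : Real.cos t < 1 := lt_of_le_of_ne (Real.cos_le_one t) ht
  have h2 : t ≠ 0 := fun h => ht (by simp [h])
  have h3 := Real.rpow_pos_of_pos (abs_pos.2 h2) (-1 - α)
  simp only [ne_eq, ENNReal.ofReal_eq_zero, not_le]
  have : 0 < 1 - Real.cos t := by linarith
  positivity

/-- A finite measure on the line is determined by its integrals of `x ↦ |x + b|^α` up to an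
additive constant. -/
theorem ext_of_integral_abs_add_rpow {α : ℝ} (hα : 0 < α) (hα2 : α < 2) {ν₁ ν₂ : Measure ℝ}
    [IsFiniteMeasure ν₁] [IsFiniteMeasure ν₂]
    (h₁ : ∀ b : ℝ, Integrable (fun x => |x + b| ^ α) ν₁)
    (h₂ : ∀ b : ℝ, Integrable (fun x => |x + b| ^ α) ν₂) (c : ℝ)
    (h : ∀ b : ℝ, ∫ x, |x + b| ^ α ∂ν₁ = ∫ x, |x + b| ^ α ∂ν₂ + c) : ν₁ = ν₂ := by
  have := isFiniteMeasure_cosMeasure hα hα2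
  -- By Fubini, integrating the characteristic function of `ν` against `cosMeasure` gives a second
  -- difference in `b` of the integrals of `|x + b|^α`.
  have swap : ∀ (ν : Measure ℝ) [IsFiniteMeasure ν]
      (_ : ∀ b : ℝ, Integrable (fun x => |x + b| ^ α) ν) (b : ℝ),
      ∫ t, Complex.exp (b * t * Complex.I) * charFun ν t ∂(cosMeasure α)
        = ((((∫ x, |x + (b + 1)| ^ α ∂ν) + (∫ x, |x + (b - 1)| ^ α ∂ν)
          - 2 * ∫ x, |x + b| ^ α ∂ν) * cosConst α : ℝ) : ℂ) := by
    intro ν _ hν b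
    have e : ∀ t : ℝ, Complex.exp (b * t * Complex.I) * charFun ν t
        = ∫ x : ℝ, Complex.exp ((x + b : ℝ) * t * Complex.I) ∂ν := fun t => by
      rw [charFun_apply_real, ← integral_const_mul]
      congr with x
      rw [← Complex.exp_add]; push_cast; ring_nf
    simp_rw [e]
    rw [integral_integral_swap]
    · simp_rw [← charFun_apply_real, charFun_cosMeasure hα hα2]
      rw [integral_complex_ofReal, integral_mul_const]
      have e2 : ∀ x : ℝ, |x + b + 1| ^ α + |x + b - 1| ^ α - 2 * |x + b| ^ α
          = (|x + (b + 1)| ^ α + |x + (b - 1)| ^ α) - 2 * |x + b| ^ α := fun x => by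
        rw [add_assoc, add_sub_assoc x]
      simp_rw [e2]
      rw [integral_sub (by exact (hν _).add (hν _)) ((hν _).const_mul 2), integral_add (hν _) (hν _),
        integral_const_mul]
    · refine Integrable.of_bound (C := 1) (by fun_prop) (ae_of_all _ fun p => ?_)
      simp only [Function.uncurry]
      rw [← Complex.ofReal_mul, Complex.norm_exp_ofReal_mul_I]
  have bd : ∀ (ν : Measure ℝ) [IsFiniteMeasure ν], Integrable (charFun ν) (cosMeasure α) :=
    fun ν _ => Integrable.of_bound (C := ν.real univ) (by fun_prop)
      (ae_of_all _ fun t => norm_charFun_le t)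
  have hmul : ∀ (ν : Measure ℝ) [IsFiniteMeasure ν] (b : ℝ),
      Integrable (fun t : ℝ => Complex.exp (b * t * Complex.I) * charFun ν t) (cosMeasure α) :=
    fun ν _ b => (bd ν).bdd_mul (c := 1) (by fun_prop) (ae_of_all _ fun t => by
      rw [← Complex.ofReal_mul, Complex.norm_exp_ofReal_mul_I])
  have hae : charFun ν₁ - charFun ν₂ =ᵐ[cosMeasure α] 0 := by
    -- The second difference cancels the constant `c`. Both sides carry the factor `cosConst α`,
    -- whose value is therefore irrelevant.
    refine ae_eq_zero_of_fourier ((bd ν₁).sub (bd ν₂)) (by fun_prop) fun b => ?_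
    simp_rw [Pi.sub_apply, mul_sub]
    rw [integral_sub (hmul ν₁ b) (hmul ν₂ b), swap ν₁ h₁, swap ν₂ h₂, ← Complex.ofReal_sub,
      h, h, h]
    push_cast
    ring
  refine Measure.ext_of_charFun ?_
  refine (Continuous.ae_eq_iff_eq (volume : Measure ℝ) (continuous_charFun_real ν₁)
    (continuous_charFun_real ν₂)).1 ?_
  filter_upwards [(volume_absolutelyContinuous_cosMeasure α).ae_le hae] with t ht
  simpa [sub_eq_zero] using ht

/-! ### Norms as integrals, weighted measures and ratio laws -/

lemma measurable_coe (h : LAlpha α μ) : Measurable h := (Lp.stronglyMeasurable h).measurable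

lemma integrable_abs_rpow (hα : 0 < α) (h : LAlpha α μ) :
    Integrable (fun s => |h s| ^ α) μ := by
  have := (Lp.memLp h).integrable_norm_rpow (by simpa using hα) (by simp)
  simpa [ENNReal.toReal_ofReal hα.le] using this

lemma norm_eq_integral (hα : 0 < α) (h : LAlpha α μ) :
    ‖h‖ = (∫ s, |h s| ^ α ∂μ) ^ α⁻¹ := by
  rw [Lp.norm_def, (Lp.memLp h).eLpNorm_eq_integral_rpow_norm (by simpa using hα) (by simp),
    ENNReal.toReal_ofReal_eq_iff.2]
  · simp [ENNReal.toReal_ofReal hα.le]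
  · exact Real.rpow_nonneg (integral_nonneg fun s => Real.rpow_nonneg (norm_nonneg _) _) _

lemma norm_eq_norm_iff (hα : 0 < α) (h : LAlpha α μ₁) (k : LAlpha α μ₂) :
    ‖h‖ = ‖k‖ ↔ ∫ s, |h s| ^ α ∂μ₁ = ∫ s, |k s| ^ α ∂μ₂ := by
  rw [norm_eq_integral hα, norm_eq_integral hα, Real.rpow_left_inj]
  · exact integral_nonneg fun s => Real.rpow_nonneg (abs_nonneg _) _
  · exact integral_nonneg fun s => Real.rpow_nonneg (abs_nonneg _) _
  · exact inv_ne_zero hα.ne'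

/-- The finite measure `|h|^α dμ`. -/
def weight (h : LAlpha α μ) : Measure S :=
  μ.withDensity fun s => ENNReal.ofReal (|h s| ^ α)

lemma measurable_abs_rpow (h : LAlpha α μ) : Measurable fun s => |h s| ^ α :=
  (measurable_coe h).abs.pow_const α

lemma isFiniteMeasure_weight (hα : 0 < α) (h : LAlpha α μ) : IsFiniteMeasure (weight h) :=
  isFiniteMeasure_withDensity_ofReal (integrable_abs_rpow hα h).2

lemma integral_weight (h : LAlpha α μ) (G : S → ℝ) :
    ∫ s, G s ∂(weight h) = ∫ s, |h s| ^ α * G s ∂μ := by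
  rw [weight, integral_withDensity_eq_integral_toReal_smul (measurable_abs_rpow h).ennreal_ofReal
    (ae_of_all _ fun _ => ENNReal.ofReal_lt_top)]
  simp_rw [ENNReal.toReal_ofReal (Real.rpow_nonneg (abs_nonneg _) _), smul_eq_mul]

lemma integrable_weight_iff (h : LAlpha α μ) (G : S → ℝ) :
    Integrable G (weight h) ↔ Integrable (fun s => |h s| ^ α * G s) μ := by
  rw [weight, integrable_withDensity_iff_integrable_smul' (measurable_abs_rpow h).ennreal_ofReal
    (ae_of_all _ fun _ => ENNReal.ofReal_lt_top)]
  simp_rw [ENNReal.toReal_ofReal (Real.rpow_nonneg (abs_nonneg _) _), smul_eq_mul]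

lemma ae_weight_iff (hα : 0 < α) (h : LAlpha α μ) {p : S → Prop} :
    (∀ᵐ s ∂(weight h), p s) ↔ ∀ᵐ s ∂μ, h s ≠ 0 → p s := by
  rw [weight, ae_withDensity_iff (measurable_abs_rpow h).ennreal_ofReal]
  refine eventually_congr (ae_of_all _ fun s => ?_)
  rw [ne_eq, ENNReal.ofReal_eq_zero, not_le]
  refine imp_congr_left ⟨fun hs h0 => ?_, fun h0 => Real.rpow_pos_of_pos (abs_pos.2 h0) _⟩
  simp [h0, Real.zero_rpow hα.ne'] at hs

/-- The family of ratios `f i / f i₀`. -/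
def ratios (f : ι → LAlpha α μ) (i₀ : ι) (s : S) : ι → ℝ := fun i => f i s / f i₀ s

lemma measurable_ratios (f : ι → LAlpha α μ) (i₀ : ι) : Measurable (ratios f i₀) :=
  measurable_pi_lambda _ fun i => (measurable_coe (f i)).div (measurable_coe (f i₀))

/-- The joint law of the ratios `f i / f i₀` under `|f i₀|^α dμ`. -/
def ratioLaw (f : ι → LAlpha α μ) (i₀ : ι) : Measure (ι → ℝ) :=
  (weight (f i₀)).map (ratios f i₀)

lemma isFiniteMeasure_ratioLaw (hα : 0 < α) (f : ι → LAlpha α μ) (i₀ : ι) :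
    IsFiniteMeasure (ratioLaw f i₀) := by
  have := isFiniteMeasure_weight hα (f i₀)
  exact Measure.isFiniteMeasure_map _ _

/-! ### Linear combinations determine the joint law of the ratios -/

/-- The weight `|a|^α` kills the left side at `a = 0`, whereas `|x + b a|^α` is then `|x|^α`. The
correction does not depend on `b`, so after integration it is a constant. -/
lemma abs_rpow_mul_abs_div_add {a : ℝ} (hα : 0 < α) (x b : ℝ) :
    |a| ^ α * |x / a + b| ^ α = |x + b * a| ^ α - {a : ℝ | a = 0}.indicator (fun _ => |x| ^ α) a := by
  rcases eq_or_ne a 0 with rfl | ha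
  · simp [Real.zero_rpow hα.ne']
  · rw [indicator_of_notMem (by simpa using ha), sub_zero,
      ← Real.mul_rpow (abs_nonneg _) (abs_nonneg _), ← abs_mul]
    congr 2
    field_simp

lemma coeFn_add_smul (h f₀ : LAlpha α μ) (b : ℝ) :
    ⇑(h + b • f₀) =ᵐ[μ] fun s => h s + b * f₀ s := by
  filter_upwards [Lp.coeFn_add h (b • f₀), Lp.coeFn_smul b f₀] with s h1 h2
  rw [h1, Pi.add_apply, h2, Pi.smul_apply, smul_eq_mul]

lemma integrable_abs_add_rpow_weight (hα : 0 < α) (h f₀ : LAlpha α μ) (b : ℝ) :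
    Integrable (fun s => |h s + b * f₀ s| ^ α) μ ∧
    Integrable (fun s => {a : ℝ | a = 0}.indicator (fun _ => |h s| ^ α) (f₀ s)) μ := by
  constructor
  · refine (integrable_abs_rpow hα (h + b • f₀)).congr ?_
    filter_upwards [coeFn_add_smul h f₀ b] with s hs
    rw [hs]
  · have : (fun s => {a : ℝ | a = 0}.indicator (fun _ => |h s| ^ α) (f₀ s))
        = (f₀ ⁻¹' {0}).indicator fun s => |h s| ^ α := by
      ext s
      by_cases hs : f₀ s = 0 <;> simp [hs]
    rw [this]
    exact (integrable_abs_rpow hα h).indicator (measurable_coe f₀ (measurableSet_singleton 0))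

/-- If `‖h + b f₀‖ = ‖k + b g₀‖` for all `b`, then `h / f₀` under `|f₀|^α dμ₁` and `k / g₀` under
`|g₀|^α dμ₂` have the same law. -/
lemma map_div_weight_eq (hα : 0 < α) (hα2 : α < 2) {h f₀ : LAlpha α μ₁} {k g₀ : LAlpha α μ₂}
    (H : ∀ b : ℝ, ‖h + b • f₀‖ = ‖k + b • g₀‖) :
    (weight f₀).map (fun s => h s / f₀ s) = (weight g₀).map fun s => k s / g₀ s := by
  have e1 := isFiniteMeasure_weight hα f₀
  have e2 := isFiniteMeasure_weight hα g₀
  have f1 := Measure.isFiniteMeasure_map (weight f₀) fun s => h s / f₀ s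
  have f2 := Measure.isFiniteMeasure_map (weight g₀) fun s => k s / g₀ s
  have m : ∀ b : ℝ, Measurable fun x : ℝ => |x + b| ^ α := fun b => by fun_prop
  have m1 : AEMeasurable (fun s => h s / f₀ s) (weight f₀) :=
    ((measurable_coe h).div (measurable_coe f₀)).aemeasurable
  have m2 : AEMeasurable (fun s => k s / g₀ s) (weight g₀) :=
    ((measurable_coe k).div (measurable_coe g₀)).aemeasurable
  refine ext_of_integral_abs_add_rpow hα hα2
    -- The norms also see `h` off the support of `f₀` and `k` off that of `g₀`, which the weighted
    -- laws ignore; `c` is the difference of these two contributions.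
    (c := ∫ s, {a : ℝ | a = 0}.indicator (fun _ => |k s| ^ α) (g₀ s) ∂μ₂
      - ∫ s, {a : ℝ | a = 0}.indicator (fun _ => |h s| ^ α) (f₀ s) ∂μ₁)
    (fun b => ?_) (fun b => ?_) (fun b => ?_)
  · rw [integrable_map_measure (m b).aestronglyMeasurable m1, Function.comp_def,
      integrable_weight_iff]
    simp_rw [abs_rpow_mul_abs_div_add hα]
    exact (integrable_abs_add_rpow_weight hα h f₀ b).1.sub
      (integrable_abs_add_rpow_weight hα h f₀ b).2
  · rw [integrable_map_measure (m b).aestronglyMeasurable m2, Function.comp_def,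
      integrable_weight_iff]
    simp_rw [abs_rpow_mul_abs_div_add hα]
    exact (integrable_abs_add_rpow_weight hα k g₀ b).1.sub
      (integrable_abs_add_rpow_weight hα k g₀ b).2
  · rw [integral_map m1 (m b).aestronglyMeasurable, integral_map m2 (m b).aestronglyMeasurable,
      integral_weight, integral_weight]
    simp_rw [abs_rpow_mul_abs_div_add hα]
    rw [integral_sub (integrable_abs_add_rpow_weight hα h f₀ b).1
      (integrable_abs_add_rpow_weight hα h f₀ b).2,
      integral_sub (integrable_abs_add_rpow_weight hα k g₀ b).1
      (integrable_abs_add_rpow_weight hα k g₀ b).2]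
    have := (norm_eq_norm_iff hα _ _).1 (H b)
    have c1 : ∫ s, |(h + b • f₀) s| ^ α ∂μ₁ = ∫ s, |h s + b * f₀ s| ^ α ∂μ₁ :=
      integral_congr_ae (by filter_upwards [coeFn_add_smul h f₀ b] with s hs; rw [hs])
    have c2 : ∫ s, |(k + b • g₀) s| ^ α ∂μ₂ = ∫ s, |k s + b * g₀ s| ^ α ∂μ₂ :=
      integral_congr_ae (by filter_upwards [coeFn_add_smul k g₀ b] with s hs; rw [hs])
    linarith

lemma coeFn_linearCombination (f : ι → LAlpha α μ) (a : ι →₀ ℝ) :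
    ⇑(Finsupp.linearCombination ℝ f a) =ᵐ[μ]
      fun s => Finsupp.linearCombination ℝ (fun i => f i s) a := by
  induction a using Finsupp.induction_linear with
  | zero =>
    simp only [map_zero]
    exact Lp.coeFn_zero _ _ _
  | add a b ha hb =>
    simp only [map_add]
    filter_upwards [ha, hb, Lp.coeFn_add (Finsupp.linearCombination ℝ f a)
      (Finsupp.linearCombination ℝ f b)] with s h1 h2 h3
    rw [h3, Pi.add_apply, h1, h2]
  | single i c =>
    simp only [Finsupp.linearCombination_single]
    exact Lp.coeFn_smul c (f i)

lemma map_linearCombination_ratioLaw (hα : 0 < α) (f : ι → LAlpha α μ) (i₀ : ι) (a : ι →₀ ℝ) :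
    (ratioLaw f i₀).map (fun x => Finsupp.linearCombination ℝ x a)
      = (weight (f i₀)).map fun s => Finsupp.linearCombination ℝ f a s / f i₀ s := by
  have hm : Measurable fun x : ι → ℝ => Finsupp.linearCombination ℝ x a := by
    simp_rw [Finsupp.linearCombination_apply, Finsupp.sum]
    fun_prop
  rw [ratioLaw, Measure.map_map hm (measurable_ratios f i₀)]
  refine Measure.map_congr ?_
  refine (ae_weight_iff hα _).2 ?_
  filter_upwards [coeFn_linearCombination f a] with s hs _
  rw [hs, Function.comp_apply]
  simp_rw [Finsupp.linearCombination_apply, Finsupp.sum, Finset.sum_div, ratios, smul_eq_mul,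
    mul_div_assoc]

/-- Cramér–Wold: a finite measure on a product is determined by its finite marginals, these by their
characteristic functions, and those by the laws of linear combinations of the coordinates. -/
theorem ratioLaw_eq_of_norm_linearCombination (hα : 0 < α) (hα2 : α < 2)
    {f : ι → LAlpha α μ₁} {g : ι → LAlpha α μ₂} (i₀ : ι)
    (H : ∀ a : ι →₀ ℝ,
      ‖Finsupp.linearCombination ℝ f a‖ = ‖Finsupp.linearCombination ℝ g a‖) :
    ratioLaw f i₀ = ratioLaw g i₀ := by
  classical
  have e1 := isFiniteMeasure_ratioLaw hα f i₀
  have e2 := isFiniteMeasure_ratioLaw hα g i₀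
  have key : ∀ a : ι →₀ ℝ, (ratioLaw f i₀).map (fun x => Finsupp.linearCombination ℝ x a)
      = (ratioLaw g i₀).map fun x => Finsupp.linearCombination ℝ x a := fun a => by
    rw [map_linearCombination_ratioLaw hα, map_linearCombination_ratioLaw hα]
    refine map_div_weight_eq hα hα2 fun b => ?_
    -- The shift `b f i₀` is itself part of a linear combination of the family.
    simpa using H (a + Finsupp.single i₀ b)
  refine IsProjectiveLimit.unique (P := fun I => (ratioLaw g i₀).map I.restrict) (fun I => ?_)
    (fun I => rfl)
  refine Measure.ext_of_charFunDual (funext fun L => ?_)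
  set a : ι →₀ ℝ := ∑ i : I, Finsupp.single (i : ι) (L (Pi.single i 1)) with ha
  have hL : ∀ x : ι → ℝ, L (I.restrict x) = Finsupp.linearCombination ℝ x a := fun x => by
    rw [ha, map_sum]
    simp only [Finsupp.linearCombination_single, smul_eq_mul]
    conv_lhs => rw [← Finset.univ_sum_single (I.restrict x), map_sum]
    refine Finset.sum_congr rfl fun i _ => ?_
    have : (Pi.single i (I.restrict x i) : I → ℝ) = x i • Pi.single i 1 := by
      rw [← Pi.single_smul]; simp
    rw [this, map_smul, smul_eq_mul, mul_comm]
  have hm : Measurable fun x : ι → ℝ => Finsupp.linearCombination ℝ x a := by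
    simp_rw [Finsupp.linearCombination_apply, Finsupp.sum]
    fun_prop
  have hr : ∀ (m : Measure (ι → ℝ)), charFunDual (m.map I.restrict) L
      = charFun (m.map fun x => Finsupp.linearCombination ℝ x a) 1 := fun m => by
    rw [charFunDual_apply, charFun_apply_real,
      integral_map (by fun_prop) (by fun_prop), integral_map hm.aemeasurable (by fun_prop)]
    simp [hL]
  rw [hr, hr, key]

/-! ### Max-linear combinations determine the joint law of the ratios -/

lemma coeFn_nonneg {h : LAlpha α μ} (hh : 0 ≤ h) : ∀ᵐ s ∂μ, 0 ≤ h s :=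
  (Lp.coeFn_nonneg h).2 hh

lemma coeFn_sup_smul (h f₀ : LAlpha α μ) (t : ℝ) :
    ⇑(h ⊔ t • f₀) =ᵐ[μ] fun s => max (h s) (t * f₀ s) := by
  filter_upwards [Lp.coeFn_sup h (t • f₀), Lp.coeFn_smul t f₀] with s h1 h2
  rw [h1, Pi.sup_apply, h2, Pi.smul_apply, smul_eq_mul]

/-- Supplies the bound `y^α` on the difference quotient, uniform in `t`, for dominated convergence.
-/
lemma max_rpow_sub_bounds (hα : 0 < α) {x y t : ℝ} (hx : 0 ≤ x) (hy : 0 ≤ y) (ht : 0 < t)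
    (ht1 : t < 1) :
    0 ≤ max x y ^ α - max x (t * y) ^ α ∧
      max x y ^ α - max x (t * y) ^ α ≤ (1 - t ^ α) * y ^ α := by
  have hty : t * y ≤ y := by nlinarith
  have h1 : t ^ α ≤ 1 := Real.rpow_le_one ht.le ht1.le hα.le
  have hyα : 0 ≤ y ^ α := Real.rpow_nonneg hy _
  have e : (t * y) ^ α = t ^ α * y ^ α := Real.mul_rpow ht.le hy
  have h0 : 0 ≤ t * y := mul_nonneg ht.le hy
  refine ⟨sub_nonneg.2 (Real.rpow_le_rpow (le_max_of_le_left hx) (max_le_max le_rfl hty) hα.le), ?_⟩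
  rcases le_total y x with h | h
  · rw [max_eq_left h, max_eq_left (hty.trans h), sub_self]
    exact mul_nonneg (by linarith) hyα
  · rw [max_eq_right h, sub_mul, one_mul, ← e]
    have := Real.rpow_le_rpow h0 (le_max_right x (t * y)) hα.le
    linarith

/-- The quotient is eventually constant: if `x < y`, then `x ≤ t y` for `t` near `1` and it equals
`y^α`; if `y ≤ x`, the numerator is zero. Approaching from the left produces the strict inequality
in the indicator. -/
lemma tendsto_max_rpow_sub_div (hα : 0 < α) {x y : ℝ} (hx : 0 ≤ x) (hy : 0 ≤ y) :
    Tendsto (fun t : ℝ => (max x y ^ α - max x (t * y) ^ α) / (1 - t ^ α)) (𝓝[<] 1)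
      (𝓝 ({p : ℝ × ℝ | p.1 < p.2}.indicator (fun p => p.2 ^ α) (x, y))) := by
  rcases lt_or_ge x y with h | h
  · rw [indicator_of_mem (by exact h)]
    refine tendsto_const_nhds.congr' ?_
    have hxy : x / y < 1 := (div_lt_one (hx.trans_lt h)).2 h
    filter_upwards [Ioo_mem_nhdsLT (max_lt hxy zero_lt_one)] with t ht
    have h1 : x ≤ t * y := ((div_lt_iff₀ (hx.trans_lt h)).1 ((le_max_left _ _).trans_lt ht.1)).le
    have ht0 : 0 < t := (le_max_right _ _).trans_lt ht.1
    have h2 : t ^ α < 1 := Real.rpow_lt_one ht0.le ht.2 hα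
    rw [max_eq_right h.le, max_eq_right h1, Real.mul_rpow ht0.le hy, eq_div_iff (by linarith)]
    ring
  · rw [indicator_of_notMem (by simpa using h)]
    refine tendsto_const_nhds.congr' ?_
    filter_upwards [Ioo_mem_nhdsLT (zero_lt_one (α := ℝ))] with t ht
    rw [max_eq_left h, max_eq_left, sub_self, zero_div]
    nlinarith [ht.1, ht.2]

lemma tendsto_integral_max_rpow (hα : 0 < α) {h f₀ : LAlpha α μ} (hh : 0 ≤ h) (hf : 0 ≤ f₀) :
    Tendsto (fun t : ℝ => (∫ s, |(h ⊔ (1 : ℝ) • f₀) s| ^ α ∂μ - ∫ s, |(h ⊔ t • f₀) s| ^ α ∂μ)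
      / (1 - t ^ α)) (𝓝[<] 1) (𝓝 ((weight f₀).real {s | h s < f₀ s})) := by
  have fin := isFiniteMeasure_weight hα f₀
  have hms : MeasurableSet {s | h s < f₀ s} :=
    measurableSet_lt (measurable_coe h) (measurable_coe f₀)
  have lim : (weight f₀).real {s | h s < f₀ s}
      = ∫ s, {p : ℝ × ℝ | p.1 < p.2}.indicator (fun p => p.2 ^ α) (h s, f₀ s) ∂μ := by
    rw [← integral_indicator_one hms, integral_weight]
    refine integral_congr_ae ?_
    filter_upwards [coeFn_nonneg hf] with s hs
    rw [abs_of_nonneg hs]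
    by_cases hlt : h s < f₀ s <;> simp [hlt]
  have int : ∀ t : ℝ, 0 < t → ∫ s, |(h ⊔ t • f₀) s| ^ α ∂μ = ∫ s, max (h s) (t * f₀ s) ^ α ∂μ ∧
      Integrable (fun s => max (h s) (t * f₀ s) ^ α) μ := fun t ht => by
    have : (fun s => |(h ⊔ t • f₀) s| ^ α) =ᵐ[μ] fun s => max (h s) (t * f₀ s) ^ α := by
      filter_upwards [coeFn_nonneg hh, coeFn_sup_smul h f₀ t] with s h1 h2
      rw [h2, abs_of_nonneg (le_max_of_le_left h1)]
    exact ⟨integral_congr_ae this, (integrable_abs_rpow hα _).congr this⟩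
  have i1 := int 1 one_pos
  simp only [one_mul] at i1
  rw [lim]
  have key : Tendsto (fun t : ℝ => ∫ s, (max (h s) (f₀ s) ^ α - max (h s) (t * f₀ s) ^ α)
      / (1 - t ^ α) ∂μ) (𝓝[<] 1)
      (𝓝 (∫ s, {p : ℝ × ℝ | p.1 < p.2}.indicator (fun p => p.2 ^ α) (h s, f₀ s) ∂μ)) := by
    refine tendsto_integral_filter_of_dominated_convergence (fun s => |f₀ s| ^ α)
      (Eventually.of_forall fun t => ?_) ?_ (integrable_abs_rpow hα f₀) ?_
    · have m1 := measurable_coe h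
      have m2 := measurable_coe f₀
      exact Measurable.aestronglyMeasurable (by fun_prop)
    · filter_upwards [Ioo_mem_nhdsLT (zero_lt_one (α := ℝ))] with t ht
      filter_upwards [coeFn_nonneg hh, coeFn_nonneg hf] with s h1 h2
      have b := max_rpow_sub_bounds hα h1 h2 ht.1 ht.2
      have h3 : 0 < 1 - t ^ α := by linarith [Real.rpow_lt_one ht.1.le ht.2 hα]
      rw [Real.norm_of_nonneg (div_nonneg b.1 h3.le), div_le_iff₀ h3, abs_of_nonneg h2]
      linarith [b.2]
    · filter_upwards [coeFn_nonneg hh, coeFn_nonneg hf] with s h1 h2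
      exact tendsto_max_rpow_sub_div hα h1 h2
  refine key.congr' ?_
  filter_upwards [Ioo_mem_nhdsLT (zero_lt_one (α := ℝ))] with t ht
  rw [integral_div, integral_sub i1.2 (int t ht.1).2, i1.1, (int t ht.1).1]

lemma weight_lt_eq (hα : 0 < α) {h f₀ : LAlpha α μ₁} {k g₀ : LAlpha α μ₂}
    (hh : 0 ≤ h) (hf : 0 ≤ f₀) (hk : 0 ≤ k) (hg : 0 ≤ g₀)
    (H : ∀ t : ℝ, 0 < t → ‖h ⊔ t • f₀‖ = ‖k ⊔ t • g₀‖) :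
    weight f₀ {s | h s < f₀ s} = weight g₀ {s | k s < g₀ s} := by
  have e1 := isFiniteMeasure_weight hα f₀
  have e2 := isFiniteMeasure_weight hα g₀
  have l1 := tendsto_integral_max_rpow hα hh hf
  have l2 := tendsto_integral_max_rpow hα hk hg
  rw [← measureReal_eq_measureReal_iff]
  refine tendsto_nhds_unique l1 (l2.congr' ?_)
  filter_upwards [Ioo_mem_nhdsLT (zero_lt_one (α := ℝ))] with t ht
  rw [(norm_eq_norm_iff hα _ _).1 (H t ht.1), (norm_eq_norm_iff hα _ _).1 (H 1 one_pos)]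

lemma measurableSet_box (I : Finset ι) (c : ι → ℝ) :
    MeasurableSet {x : ι → ℝ | ∀ i ∈ I, x i < c i} := by
  have : {x : ι → ℝ | ∀ i ∈ I, x i < c i} = ⋂ i ∈ I, {x | x i < c i} := by ext; simp
  rw [this]
  exact Finset.measurableSet_biInter _ fun i _ =>
    measurableSet_lt (measurable_pi_apply i) measurable_const

/-- A finite measure on `ι → ℝ` is determined by its values on the boxes. -/
lemma ext_of_box {m₁ m₂ : Measure (ι → ℝ)} [IsFiniteMeasure m₁]
    (H : ∀ (I : Finset ι) (c : ι → ℝ),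
      m₁ {x | ∀ i ∈ I, x i < c i} = m₂ {x | ∀ i ∈ I, x i < c i}) : m₁ = m₂ := by
  classical
  refine ext_of_generate_finite
    {A | ∃ (I : Finset ι) (c : ι → ℝ), A = {x | ∀ i ∈ I, x i < c i}} (le_antisymm ?_ ?_) ?_ ?_ ?_
  · refine iSup_le fun i => ?_
    rw [BorelSpace.measurable_eq.trans (borel_eq_generateFrom_Iio ℝ),
      MeasurableSpace.comap_generateFrom]
    refine MeasurableSpace.generateFrom_le ?_
    rintro _ ⟨_, ⟨c, rfl⟩, rfl⟩
    refine MeasurableSpace.measurableSet_generateFrom ⟨{i}, fun _ => c, ?_⟩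
    ext; simp
  · refine MeasurableSpace.generateFrom_le ?_
    rintro _ ⟨I, c, rfl⟩
    exact measurableSet_box I c
  · rintro _ ⟨I, c, rfl⟩ _ ⟨J, d, rfl⟩ _
    -- An intersection of boxes is a box, with the smaller bound on common coordinates.
    refine ⟨I ∪ J, fun i => if i ∈ I then (if i ∈ J then min (c i) (d i) else c i) else d i, ?_⟩
    ext x
    simp only [mem_inter_iff, mem_ofPred_eq, Finset.mem_union, ← forall_and]
    refine forall_congr' fun i => ?_
    by_cases h1 : i ∈ I <;> by_cases h2 : i ∈ J <;> simp [h1, h2]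
  · rintro _ ⟨I, c, rfl⟩
    exact H I c
  · simpa using H ∅ fun _ => 0

lemma coeFn_sup' (f : ι → LAlpha α μ) {I : Finset ι} (hI : I.Nonempty) :
    ⇑(I.sup' hI f) =ᵐ[μ] fun s => I.sup' hI fun i => f i s := by
  induction hI using Finset.Nonempty.cons_induction with
  | singleton a => simp
  | cons a I ha hI ih =>
    rw [Finset.sup'_cons hI]
    filter_upwards [ih, Lp.coeFn_sup (f a) (I.sup' hI f)] with s h1 h2
    rw [h2, Pi.sup_apply, h1, Finset.sup'_cons hI]

/-- Where the weight lives `f i₀` is positive, so denominators clear and the finitely many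
inequalities merge into one for the maximum. -/
lemma ratioLaw_box (hα : 0 < α) (f : ι → LAlpha α μ) (i₀ : ι) (hf : ∀ i, 0 ≤ f i)
    {I : Finset ι} (hI : I.Nonempty) (c : ι → ℝ) (hc : ∀ i ∈ I, 0 < c i) :
    ratioLaw f i₀ {x | ∀ i ∈ I, x i < c i}
      = weight (f i₀) {s | I.sup' hI (fun i => (c i)⁻¹ • f i) s < f i₀ s} := by
  rw [ratioLaw, Measure.map_apply (measurable_ratios f i₀) (measurableSet_box I c)]
  refine measure_congr ?_
  refine (ae_weight_iff hα _).2 ?_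
  have hsm : ∀ᵐ s ∂μ, ∀ i ∈ I, ((c i)⁻¹ • f i) s = (c i)⁻¹ * f i s :=
    (ae_ball_iff (Finset.countable_toSet I)).2 fun i _ => Lp.coeFn_smul (c i)⁻¹ (f i)
  filter_upwards [coeFn_sup' (fun i => (c i)⁻¹ • f i) hI, hsm, coeFn_nonneg (hf i₀)]
    with s h1 h2 h3 h0
  have h4 : 0 < f i₀ s := lt_of_le_of_ne h3 (Ne.symm h0)
  refine propext ?_
  change (∀ i ∈ I, f i s / f i₀ s < c i) ↔ (I.sup' hI fun i => (c i)⁻¹ • f i) s < f i₀ s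
  rw [h1, Finset.sup'_lt_iff]
  refine forall₂_congr fun i hi => ?_
  rw [h2 i hi, div_lt_iff₀ h4, inv_mul_lt_iff₀ (hc i hi)]

lemma ratioLaw_box_eq_zero (hα : 0 < α) (f : ι → LAlpha α μ) (i₀ : ι) (hf : ∀ i, 0 ≤ f i)
    {I : Finset ι} (c : ι → ℝ) {i : ι} (hi : i ∈ I) (hc : c i ≤ 0) :
    ratioLaw f i₀ {x | ∀ i ∈ I, x i < c i} = 0 := by
  rw [ratioLaw, Measure.map_apply (measurable_ratios f i₀) (measurableSet_box I c),
    measure_eq_zero_iff_ae_notMem]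
  refine (ae_weight_iff hα _).2 ?_
  filter_upwards [coeFn_nonneg (hf i), coeFn_nonneg (hf i₀)] with s h1 h2 _ h3
  have : f i s / f i₀ s < c i := h3 i hi
  linarith [div_nonneg h1 h2]

lemma ratioLaw_univ (hα : 0 < α) (f : ι → LAlpha α μ) (i₀ : ι) :
    ratioLaw f i₀ univ = ENNReal.ofReal (∫ s, |f i₀ s| ^ α ∂μ) := by
  rw [ratioLaw, Measure.map_apply (measurable_ratios f i₀) MeasurableSet.univ, preimage_univ,
    weight, withDensity_apply _ MeasurableSet.univ, Measure.restrict_univ,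
    ofReal_integral_eq_lintegral_ofReal (integrable_abs_rpow hα _)
      (ae_of_all _ fun _ => Real.rpow_nonneg (abs_nonneg _) _)]

/-- A norm-preserving correspondence compatible with maxima preserves the joint law of ratios. -/
theorem ratioLaw_eq_of_max (hα : 0 < α) (R : LAlpha α μ₁ → LAlpha α μ₂ → Prop)
    (R_norm : ∀ h k, R h k → ‖h‖ = ‖k‖)
    (R_nonneg : ∀ h k, R h k → 0 ≤ h ∧ 0 ≤ k)
    (R_sup : ∀ h k h' k', R h k → R h' k' → R (h ⊔ h') (k ⊔ k'))
    (R_smul : ∀ h k, R h k → ∀ a : ℝ, 0 < a → R (a • h) (a • k))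
    {f : ι → LAlpha α μ₁} {g : ι → LAlpha α μ₂} (hR : ∀ i, R (f i) (g i)) (i₀ : ι) :
    ratioLaw f i₀ = ratioLaw g i₀ := by
  have e1 := isFiniteMeasure_ratioLaw hα f i₀
  have hf : ∀ i, 0 ≤ f i := fun i => (R_nonneg _ _ (hR i)).1
  have hg : ∀ i, 0 ≤ g i := fun i => (R_nonneg _ _ (hR i)).2
  have pos : ∀ (I : Finset ι) (hI : I.Nonempty) (c : ι → ℝ), (∀ i ∈ I, 0 < c i) →
      ratioLaw f i₀ {x | ∀ i ∈ I, x i < c i} = ratioLaw g i₀ {x | ∀ i ∈ I, x i < c i} := by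
    intro I hI c hc
    rw [ratioLaw_box hα f i₀ hf hI c hc, ratioLaw_box hα g i₀ hg hI c hc]
    have hs : R (I.sup' hI fun i => (c i)⁻¹ • f i) (I.sup' hI fun i => (c i)⁻¹ • g i) := by
      induction hI using Finset.Nonempty.cons_induction with
      | singleton a =>
        exact R_smul _ _ (hR a) _ (inv_pos.2 (hc a (by simp)))
      | cons a I ha hI ih =>
        rw [Finset.sup'_cons hI, Finset.sup'_cons hI]
        exact R_sup _ _ _ _ (R_smul _ _ (hR a) _ (inv_pos.2 (hc a (by simp))))
          (ih fun i hi => hc i (by simp [hi]))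
    exact weight_lt_eq hα (R_nonneg _ _ hs).1 (hf i₀) (R_nonneg _ _ hs).2 (hg i₀) fun t ht =>
      R_norm _ _ (R_sup _ _ _ _ hs (R_smul _ _ (hR i₀) t ht))
  refine ext_of_box fun I c => ?_
  -- The empty box carries the total mass, which is the norm of the reference function; boxes with
  -- some `c i ≤ 0` are null because the ratios are nonnegative.
  rcases I.eq_empty_or_nonempty with rfl | hI
  · simp only [Finset.notMem_empty, false_imp_iff, implies_true, ofPred_true]
    rw [ratioLaw_univ hα, ratioLaw_univ hα, (norm_eq_norm_iff hα _ _).1 (R_norm _ _ (hR i₀))]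
  · by_cases hc : ∀ i ∈ I, 0 < c i
    · exact pos I hI c hc
    · push Not at hc
      obtain ⟨i, hi, hi0⟩ := hc
      rw [ratioLaw_box_eq_zero hα f i₀ hf c hi hi0, ratioLaw_box_eq_zero hα g i₀ hg c hi hi0]

/-! ### Functions of full support -/

lemma memLp_of_integrable_abs_rpow (hα : 0 < α) {f : S → ℝ} (hm : Measurable f)
    (hf : Integrable (fun s => |f s| ^ α) μ) : MemLp f (ENNReal.ofReal α) μ := by
  refine (integrable_norm_rpow_iff hm.aestronglyMeasurable (by simpa using hα) (by simp)).1 ?_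
  simpa [ENNReal.toReal_ofReal hα.le] using hf

/-- The limit of an increasing sequence of nonnegative functions bounded in `L^α`. -/
lemma exists_rho_limit (hα : 0 < α) (u : ℕ → LAlpha α μ) (hu : ∀ n, 0 ≤ u n)
    (hmono : Monotone u) (C : ℝ) (hC : ∀ n, ∫ s, |u n s| ^ α ∂μ ≤ C) :
    ∃ f : LAlpha α μ, 0 ≤ f ∧ (∀ n, u n ≤ f) ∧
      Tendsto (fun n => rho α μ (u n) f) atTop (𝓝 0) := by
  -- `G` is the supremum of the powers `|u n|^α`. The limit will be `G^(1/α)`, and `G` itself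
  -- dominates the integrands of `rho`.
  set G : S → ENNReal := fun s => ⨆ n, ENNReal.ofReal (|u n s| ^ α) with hG
  have mG : Measurable G := Measurable.iSup fun n => (measurable_abs_rpow (u n)).ennreal_ofReal
  have hpos : ∀ᵐ s ∂μ, ∀ n, 0 ≤ u n s := ae_all_iff.2 fun n => coeFn_nonneg (hu n)
  have hle : ∀ᵐ s ∂μ, Monotone fun n => u n s := by
    have : ∀ᵐ s ∂μ, ∀ n, u n s ≤ u (n + 1) s :=
      ae_all_iff.2 fun n => (Lp.coeFn_le _ _).2 (hmono n.le_succ)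
    filter_upwards [this] with s hs using monotone_nat_of_le_succ hs
  have hpow : ∀ᵐ s ∂μ, Monotone fun n => |u n s| ^ α := by
    filter_upwards [hpos, hle] with s h1 h2 n m hnm
    simp only [abs_of_nonneg (h1 _)]
    exact Real.rpow_le_rpow (h1 n) (h2 hnm) hα.le
  have hlint : ∫⁻ s, G s ∂μ ≤ ENNReal.ofReal C := by
    rw [lintegral_iSup' (fun n => (measurable_abs_rpow (u n)).ennreal_ofReal.aemeasurable)
      (by filter_upwards [hpow] with s hs n m hnm using ENNReal.ofReal_le_ofReal (hs hnm))]
    refine iSup_le fun n => ?_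
    rw [← ofReal_integral_eq_lintegral_ofReal (integrable_abs_rpow hα _)
      (ae_of_all _ fun _ => Real.rpow_nonneg (abs_nonneg _) _)]
    exact ENNReal.ofReal_le_ofReal (hC n)
  have hGfin : ∫⁻ s, G s ∂μ ≠ ⊤ := (hlint.trans_lt ENNReal.ofReal_lt_top).ne
  have hGlt : ∀ᵐ s ∂μ, G s < ⊤ := ae_lt_top mG hGfin
  have hGint : Integrable (fun s => (G s).toReal) μ := integrable_toReal_of_lintegral_ne_top
    mG.aemeasurable hGfin
  have hroot : ∀ s, |(G s).toReal ^ α⁻¹| ^ α = (G s).toReal := fun s => by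
    rw [abs_of_nonneg (Real.rpow_nonneg ENNReal.toReal_nonneg _),
      Real.rpow_inv_rpow ENNReal.toReal_nonneg hα.ne']
  have mem : MemLp (fun s => (G s).toReal ^ α⁻¹) (ENNReal.ofReal α) μ :=
    memLp_of_integrable_abs_rpow hα (by fun_prop) (by simpa only [hroot] using hGint)
  have hlepow : ∀ᵐ s ∂μ, ∀ n, |u n s| ^ α ≤ (G s).toReal := by
    filter_upwards [hGlt] with s hs n
    rw [← ENNReal.ofReal_le_iff_le_toReal hs.ne]
    exact le_iSup (fun n => ENNReal.ofReal (|u n s| ^ α)) n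
  have hcoe := mem.coeFn_toLp
  refine ⟨mem.toLp _, ?_, fun n => ?_, ?_⟩
  · rw [← Lp.coeFn_nonneg]
    filter_upwards [hcoe] with s hs
    rw [hs]
    exact Real.rpow_nonneg ENNReal.toReal_nonneg _
  · rw [← Lp.coeFn_le]
    filter_upwards [hcoe, hlepow, hpos] with s h1 h2 h3
    rw [h1, ← Real.rpow_le_rpow_iff (h3 n) (Real.rpow_nonneg ENNReal.toReal_nonneg _) hα,
      Real.rpow_inv_rpow ENNReal.toReal_nonneg hα.ne']
    simpa only [abs_of_nonneg (h3 n)] using h2 n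
  · have lim := tendsto_integral_of_dominated_convergence
      (F := fun n s => |(u n s) ^ α - (mem.toLp _ s) ^ α|) (f := fun _ => 0) (μ := μ)
      (fun s => (G s).toReal) (fun n => ?_) hGint (fun n => ?_) ?_
    · simpa [rho] using lim
    · have m1 := measurable_coe (u n)
      have m2 := measurable_coe (mem.toLp _)
      exact Measurable.aestronglyMeasurable (by fun_prop)
    · filter_upwards [hcoe, hlepow, hpos] with s h1 h2 h3
      have h2' := h2 n
      rw [abs_of_nonneg (h3 n)] at h2'
      rw [h1, Real.rpow_inv_rpow ENNReal.toReal_nonneg hα.ne', Real.norm_eq_abs, abs_abs, abs_le]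
      constructor <;> linarith [Real.rpow_nonneg (h3 n) α]
    · filter_upwards [hcoe, hpow, hpos, hGlt] with s h1 h2 h3 h4
      simp only [h1, Real.rpow_inv_rpow ENNReal.toReal_nonneg hα.ne']
      have t1 : Tendsto (fun n => ENNReal.ofReal (|u n s| ^ α)) atTop (𝓝 (G s)) :=
        tendsto_atTop_iSup fun n m hnm => ENNReal.ofReal_le_ofReal (h2 hnm)
      have t2 := (ENNReal.tendsto_toReal h4.ne).comp t1
      have t3 : Tendsto (fun n => u n s ^ α) atTop (𝓝 (G s).toReal) := by
        refine t2.congr fun n => ?_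
        rw [Function.comp_apply, ENNReal.toReal_ofReal (Real.rpow_nonneg (abs_nonneg _) _),
          abs_of_nonneg (h3 n)]
      simpa using (t3.sub_const (G s).toReal).abs

lemma tendsto_integral_add_smul (hα : 0 < α) {f g : LAlpha α μ} (hf : 0 ≤ f) (hg : 0 ≤ g) :
    Tendsto (fun c : ℝ => ∫ s, |(f + c • g) s| ^ α ∂μ) (𝓝[>] 0) (𝓝 (∫ s, |f s| ^ α ∂μ)) := by
  have e : ∀ c : ℝ, ∫ s, |(f + c • g) s| ^ α ∂μ = ∫ s, |f s + c * g s| ^ α ∂μ := fun c =>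
    integral_congr_ae (by filter_upwards [coeFn_add_smul f g c] with s hs; rw [hs])
  simp_rw [e]
  have m1 := measurable_coe f
  have m2 := measurable_coe g
  refine tendsto_integral_filter_of_dominated_convergence (fun s => |(f + (1 : ℝ) • g) s| ^ α)
      (Eventually.of_forall fun c => Measurable.aestronglyMeasurable (by fun_prop)) ?_
      (integrable_abs_rpow hα _) (ae_of_all _ fun s => ?_)
  · filter_upwards [Ioo_mem_nhdsGT (zero_lt_one (α := ℝ))] with c hc
    filter_upwards [coeFn_nonneg hf, coeFn_nonneg hg, coeFn_add_smul f g 1] with s h1 h2 h4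
    have h5 := mul_nonneg hc.1.le h2
    rw [Real.norm_of_nonneg (Real.rpow_nonneg (abs_nonneg _) _), h4]
    refine Real.rpow_le_rpow (abs_nonneg _) ?_ hα.le
    rw [abs_of_nonneg (by linarith), abs_of_nonneg (by linarith)]
    nlinarith [hc.2]
  · have : ContinuousAt (fun c : ℝ => |f s + c * g s| ^ α) 0 :=
      ContinuousAt.rpow_const (by fun_prop) (Or.inr hα.le)
    have := this.tendsto.mono_left (nhdsWithin_le_nhds (s := Ioi 0))
    simpa using this

/-- A `ρ`-closed set of nonnegative functions, containing with `f` and `g` some `h` with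
`f, c g ≤ h ≤ f + c g`, contains a function of full support. -/
theorem exists_full_support [SigmaFinite μ] (hα : 0 < α) {F : Set (LAlpha α μ)}
    (hne : F.Nonempty) (hpos : ∀ f ∈ F, 0 ≤ f) (hcl : IsRhoClosed α μ F)
    (hcomb : ∀ f ∈ F, ∀ g ∈ F, ∀ c : ℝ, 0 < c → ∃ h ∈ F, f ≤ h ∧ c • g ≤ h ∧ h ≤ f + c • g) :
    ∃ f₀ ∈ F, ∀ f ∈ F, ∀ᵐ s ∂μ, f₀ s = 0 → f s = 0 := by
  have supp : ∀ f h : LAlpha α μ, 0 ≤ f → f ≤ h → ∀ᵐ s ∂μ, h s = 0 → f s = 0 := by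
    intro f h hf hfh
    filter_upwards [coeFn_nonneg hf, (Lp.coeFn_le _ _).2 hfh] with s h1 h2 h3
    linarith
  -- The support of `g` can be absorbed at arbitrarily small cost, since `∫ |f + c g|^α` tends to `∫
  -- |f|^α` as `c` decreases to `0`.
  have step : ∀ f g : F, ∀ ε : ℝ, 0 < ε → ∃ h : F, f.1 ≤ h.1 ∧
      (∀ᵐ s ∂μ, h.1 s = 0 → g.1 s = 0) ∧ ∫ s, |h.1 s| ^ α ∂μ ≤ ∫ s, |f.1 s| ^ α ∂μ + ε := by
    rintro ⟨f, hf⟩ ⟨g, hg⟩ ε hε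
    obtain ⟨c, hc1, hc0⟩ := ((tendsto_integral_add_smul hα (hpos f hf)
      (hpos g hg)).eventually_le_const (lt_add_of_pos_right _ hε) |>.and
        self_mem_nhdsWithin).exists
    have hc0 : 0 < c := hc0
    obtain ⟨h, hh, h1, h2, h3⟩ := hcomb f hf g hg c hc0
    refine ⟨⟨h, hh⟩, h1, ?_, le_trans ?_ hc1⟩
    · filter_upwards [coeFn_nonneg (hpos g hg), (Lp.coeFn_le _ _).2 h2, Lp.coeFn_smul c g]
        with s k1 k2 k3 k4
      rw [k3, Pi.smul_apply, smul_eq_mul] at k2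
      change h s = 0 at k4
      nlinarith
    · refine integral_mono_ae (integrable_abs_rpow hα _) (integrable_abs_rpow hα _) ?_
      filter_upwards [coeFn_nonneg (hpos h hh), (Lp.coeFn_le _ _).2 h3] with s k1 k2
      exact Real.rpow_le_rpow (abs_nonneg _) (abs_le_abs_of_nonneg k1 k2) hα.le
  choose! next next_le next_supp next_int using step
  have union : ∀ v : ℕ → F, ∃ f : F, ∀ n, ∀ᵐ s ∂μ, f.1 s = 0 → (v n).1 s = 0 := by
    intro v
    -- Absorbing `v n` at cost `2^(-n-1)` keeps the increasing sequence bounded, so its limit lies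
    -- in `F` and covers all the supports.
    let u : ℕ → F := fun n => Nat.rec (v 0) (fun n w => next w (v n) ((1 / 2) ^ (n + 1))) n
    have hmono : Monotone fun n => (u n).1 := monotone_nat_of_le_succ fun n =>
      next_le _ _ _ (by positivity)
    have hint : ∀ n, ∫ s, |(u n).1 s| ^ α ∂μ ≤ ∫ s, |(v 0).1 s| ^ α ∂μ + (1 - (1 / 2) ^ n) := by
      intro n
      induction n with
      | zero => simp [u]
      | succ n ih =>
        have h1 : ∫ s, |(u (n + 1)).1 s| ^ α ∂μ ≤ ∫ s, |(u n).1 s| ^ α ∂μ + (1 / 2) ^ (n + 1) :=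
          next_int _ _ _ (by positivity)
        have h2 : ((1 : ℝ) / 2) ^ n = 2 * (1 / 2) ^ (n + 1) := by rw [pow_succ]; ring
        linarith
    obtain ⟨f, hf0, hf, hlim⟩ := exists_rho_limit hα (fun n => (u n).1)
      (fun n => hpos _ (u n).2) hmono _ fun n => (hint n).trans
        (add_le_add_right (sub_le_self 1 (by positivity)) _)
    refine ⟨⟨f, hcl _ f (fun n => (u n).2) hf0 hlim⟩, fun n => ?_⟩
    have h1 : ∀ᵐ s ∂μ, (u (n + 1)).1 s = 0 → (v n).1 s = 0 := next_supp _ _ _ (by positivity)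
    filter_upwards [h1, supp _ f (hpos _ (u (n + 1)).2) (hf (n + 1))] with s k1 k2 k3
    exact k1 (k2 k3)
  -- Exhaustion: under a finite measure with the same null sets as `μ`, the supremum of the measures
  -- of the supports is attained by `f₀`. An element of `F` above both `f₀` and `f` cannot have
  -- larger support.
  set P := μ.toFinite
  let A : LAlpha α μ → Set S := fun f => {s | f s ≠ 0}
  have mA : ∀ f, MeasurableSet (A f) := fun f =>
    (measurable_coe f (measurableSet_singleton 0)).compl
  obtain ⟨w, -, hw, hwF⟩ := exists_seq_tendsto_sSup (hne.image fun f => P (A f))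
    (OrderTop.bddAbove _)
  choose v hvF hv using hwF
  obtain ⟨⟨f₀, hf₀⟩, hsupp⟩ := union fun n => ⟨v n, hvF n⟩
  refine ⟨f₀, hf₀, fun f hf => ?_⟩
  have ac : P ≪ μ := toFinite_absolutelyContinuous μ
  have hmax : sSup ((fun f => P (A f)) '' F) ≤ P (A f₀) := by
    refine le_of_tendsto' hw fun n => ?_
    rw [← hv n]
    refine measure_mono_ae ?_
    filter_upwards [ac.ae_le (hsupp n)] with s hs h1 h2
    exact h1 (hs h2)
  obtain ⟨h, hh, h1, h2, -⟩ := hcomb f₀ hf₀ f hf 1 one_pos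
  rw [one_smul] at h2
  have hsub : A f₀ ≤ᵐ[P] A h := by
    filter_upwards [ac.ae_le (supp _ _ (hpos _ hf₀) h1)] with s hs k1 k2
    exact k1 (hs k2)
  have heq : A f₀ =ᵐ[P] A h := ae_eq_of_ae_subset_of_measure_ge hsub
    ((le_sSup (mem_image_of_mem _ hh)).trans hmax) (mA f₀).nullMeasurableSet (measure_ne_top _ _)
  filter_upwards [(absolutelyContinuous_toFinite μ).ae_le heq.mem_iff,
    supp _ _ (hpos _ hf) h2] with s k1 k2 k3
  by_contra k4
  exact k1.2 (fun k5 => k4 (k2 k5)) k3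

/-! ### The extended ratio space in terms of the ratios -/

lemma measurable_extRatio : Measurable fun p : ℝ × ℝ => extRatio p.1 p.2 := by
  unfold extRatio
  refine Measurable.ite (measurableSet_eq_fun measurable_snd measurable_const) ?_ (by fun_prop)
  refine Measurable.ite (measurableSet_lt measurable_const measurable_fst) measurable_const ?_
  exact Measurable.ite (measurableSet_lt measurable_fst measurable_const) measurable_const
    measurable_const

lemma extRatio_div_div {c : ℝ} (hc : 0 < c) (a b : ℝ) :
    extRatio (a / c) (b / c) = extRatio a b := by
  simp only [extRatio, div_eq_zero_iff, hc.ne', or_false, div_pos_iff_of_pos_right hc,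
    div_neg_iff, hc, hc.le.not_gt, and_true, and_false, false_or,
    div_div_div_cancel_right₀ hc.ne']

lemma toReal_extRatio (a b : ℝ) : (extRatio a b).toReal = a / b := by
  unfold extRatio
  split_ifs <;> simp_all

lemma measurable_extRatio_ratioSigma (f : ι → LAlpha α μ) (i j : ι) :
    Measurable[ratioSigma (range f)] fun s => extRatio (f i s) (f j s) := fun B hB =>
  MeasurableSpace.measurableSet_generateFrom
    ⟨f i, f j, measurable_coe _, measurable_coe _, ⟨f i, mem_range_self i, EventuallyEq.rfl⟩,
      ⟨f j, mem_range_self j, EventuallyEq.rfl⟩, B, hB, rfl⟩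

lemma measurable_ratios_ratioSigma (f : ι → LAlpha α μ) (i₀ : ι) :
    Measurable[ratioSigma (range f)] (ratios f i₀) := by
  refine @measurable_pi_lambda _ _ _ (ratioSigma (range f)) _ _ fun i => ?_
  have : (fun s => ratios f i₀ s i) = EReal.toReal ∘ fun s => extRatio (f i s) (f i₀ s) := by
    ext s
    simp only [ratios, Function.comp_apply, toReal_extRatio]
  rw [this]
  exact measurable_ereal_toReal.comp (measurable_extRatio_ratioSigma f i i₀)

/-- Dividing numerator and denominator by `f i₀ > 0` leaves `extRatio` unchanged, so generators are
events of the ratios. Changes of representative cost a null set each, and the property passes to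
complements and countable unions. -/
lemma exists_preimage_ratios (f : ι → LAlpha α μ) (i₀ : ι) (hf₀ : 0 ≤ f i₀) {A : Set S}
    (hA : MeasurableSet[ratioSigma (range f)] A) :
    ∃ B : Set (ι → ℝ), MeasurableSet B ∧
      ∀ᵐ s ∂μ, f i₀ s ≠ 0 → (s ∈ A ↔ ratios f i₀ s ∈ B) := by
  induction A, hA using MeasurableSpace.generateFrom_induction with
  | hC A hA _ =>
    obtain ⟨u, v, -, -, ⟨_, ⟨i, rfl⟩, hu⟩, ⟨_, ⟨j, rfl⟩, hv⟩, B, hB, rfl⟩ := hA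
    refine ⟨(fun x : ι → ℝ => extRatio (x i) (x j)) ⁻¹' B, ?_, ?_⟩
    · have : Measurable fun x : ι → ℝ => (x i, x j) :=
        (measurable_pi_apply i).prodMk (measurable_pi_apply j)
      exact (measurable_extRatio.comp this) hB
    · filter_upwards [hu, hv, coeFn_nonneg hf₀] with s h1 h2 h3 h4
      simp only [mem_preimage, ratios, h1, h2]
      rw [extRatio_div_div (lt_of_le_of_ne h3 (Ne.symm h4))]
  | empty => exact ⟨∅, MeasurableSet.empty, by simp⟩
  | compl A _ ih =>
    obtain ⟨B, hB, h⟩ := ih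
    refine ⟨Bᶜ, hB.compl, ?_⟩
    filter_upwards [h] with s hs h0
    simp [hs h0]
  | iUnion A _ ih =>
    choose B hB h using ih
    refine ⟨⋃ n, B n, MeasurableSet.iUnion hB, ?_⟩
    filter_upwards [ae_all_iff.2 h] with s hs h0
    simp [fun n => hs n h0]

lemma iInf_rat_ite_lt (r : ℝ) :
    ⨅ q : ℚ, (if r < q then ((q : ℝ) : EReal) else ⊤) = (r : EReal) := by
  refine le_antisymm (le_of_forall_gt fun c hc => ?_) (le_iInf fun q => ?_)
  · obtain ⟨q, h1, h2⟩ := EReal.lt_iff_exists_rat_btwn.1 hc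
    refine (iInf_le _ q).trans_lt ?_
    rw [if_pos (EReal.coe_lt_coe_iff.1 h1)]
    exact h2
  · split_ifs with h
    · exact EReal.coe_le_coe_iff.2 h.le
    · exact le_top

/-- A Doob–Dynkin factorization modulo null sets and on `{f i₀ ≠ 0}` only: `r` is rebuilt from its
countably many rational sublevel sets. -/
lemma exists_eq_comp_ratios (f : ι → LAlpha α μ) (i₀ : ι) (hf₀ : 0 ≤ f i₀) {r : S → ℝ}
    (hr : Measurable[ratioSigma (range f)] r) :
    ∃ ψ : (ι → ℝ) → ℝ, Measurable ψ ∧ ∀ᵐ s ∂μ, f i₀ s ≠ 0 → r s = ψ (ratios f i₀ s) := by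
  have h : ∀ q : ℚ, ∃ B : Set (ι → ℝ), MeasurableSet B ∧
      ∀ᵐ s ∂μ, f i₀ s ≠ 0 → (s ∈ r ⁻¹' Iio (q : ℝ) ↔ ratios f i₀ s ∈ B) := fun q =>
    exists_preimage_ratios f i₀ hf₀ (hr measurableSet_Iio)
  choose B hB hq using h
  classical
  refine ⟨fun x => (⨅ q : ℚ, (if x ∈ B q then ((q : ℝ) : EReal) else ⊤)).toReal, ?_, ?_⟩
  · exact (Measurable.iInf fun q => Measurable.ite (hB q) measurable_const
      measurable_const).ereal_toReal
  · filter_upwards [ae_all_iff.2 hq] with s hs h0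
    simp only [← fun q => hs q h0, mem_preimage, mem_Iio]
    rw [iInf_rat_ite_lt, EReal.toReal_coe]

/-- `h = φ(f / f i₀) f i₀`. -/
def RatioRep (f : ι → LAlpha α μ) (i₀ : ι) (φ : (ι → ℝ) → ℝ) (h : LAlpha α μ) : Prop :=
  Measurable φ ∧ h =ᵐ[μ] fun s => φ (ratios f i₀ s) * f i₀ s

/-- All members of the family vanish where `f i₀` does. -/
def FullSupport (f : ι → LAlpha α μ) (i₀ : ι) : Prop :=
  ∀ i, ∀ᵐ s ∂μ, f i₀ s = 0 → f i s = 0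

lemma ratioRep_eval {f : ι → LAlpha α μ} {i₀ : ι} (hf : FullSupport f i₀) (i : ι) :
    RatioRep f i₀ (fun x => x i) (f i) := by
  refine ⟨measurable_pi_apply i, ?_⟩
  filter_upwards [hf i] with s hs
  by_cases h0 : f i₀ s = 0
  · rw [hs h0, h0, mul_zero]
  · rw [ratios, div_mul_cancel₀ _ h0]

/-- Given `r f i`, write `r` as a function of the ratios and `f i` as its own ratio times `f i₀`.
Conversely, functions of the ratios are measurable for the ratio σ-field. -/
theorem mem_extendedRatioSpace_range_iff {f : ι → LAlpha α μ} {i₀ : ι} (hf₀ : 0 ≤ f i₀)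
    (hf : FullSupport f i₀) {h : LAlpha α μ} :
    h ∈ extendedRatioSpace (range f) ↔ ∃ φ, RatioRep f i₀ φ h := by
  constructor
  · rintro ⟨r, hr, _, ⟨i, rfl⟩, hh⟩
    obtain ⟨ψ, hψ, hψr⟩ := exists_eq_comp_ratios f i₀ hf₀ hr
    refine ⟨fun x => ψ x * x i, hψ.mul (measurable_pi_apply i), ?_⟩
    filter_upwards [hh, hψr, (ratioRep_eval hf i).2] with s h1 h2 h3
    rw [h1, mul_assoc, ← h3]
    by_cases h0 : f i₀ s = 0
    · rw [h3, h0]; simp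
    · rw [h2 h0]
  · rintro ⟨φ, hφ, hh⟩
    exact ⟨fun s => φ (ratios f i₀ s), hφ.comp (measurable_ratios_ratioSigma f i₀), f i₀,
      mem_range_self i₀, hh⟩

theorem mem_extendedPosRatioSpace_range_iff {f : ι → LAlpha α μ} {i₀ : ι} (hf₀ : 0 ≤ f i₀)
    (hf : FullSupport f i₀) {h : LAlpha α μ} :
    h ∈ extendedPosRatioSpace (range f) ↔ 0 ≤ h ∧ h ∈ extendedRatioSpace (range f) := by
  constructor
  · rintro ⟨h0, r, hr, -, hh⟩
    exact ⟨h0, r, hr, hh⟩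
  · rintro ⟨h0, hh⟩
    obtain ⟨φ, hφ, hh⟩ := (mem_extendedRatioSpace_range_iff hf₀ hf).1 hh
    -- Replacing `φ` by its absolute value does not change the product, as `h` and `f i₀` are
    -- nonnegative.
    refine ⟨h0, fun s => |φ (ratios f i₀ s)|, ?_, fun _ => abs_nonneg _, f i₀,
      mem_range_self i₀, ?_⟩
    · exact (continuous_abs.measurable.comp hφ).comp (measurable_ratios_ratioSigma f i₀)
    · filter_upwards [hh, coeFn_nonneg h0, coeFn_nonneg hf₀] with s h1 h2 h3
      rw [← abs_of_nonneg h2, h1, abs_mul, abs_of_nonneg h3]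

/-! ### Transport along a common ratio law -/

lemma eLpNorm_comp_ratios (hα : 0 < α) (f : ι → LAlpha α μ) (i₀ : ι) {φ : (ι → ℝ) → ℝ}
    (hφ : Measurable φ) :
    eLpNorm (fun s => φ (ratios f i₀ s) * f i₀ s) (ENNReal.ofReal α) μ
      = eLpNorm φ (ENNReal.ofReal α) (ratioLaw f i₀) := by
  have hα' : ENNReal.ofReal α ≠ 0 := by simpa using hα
  rw [eLpNorm_eq_lintegral_rpow_enorm_toReal hα' (by simp),
    eLpNorm_eq_lintegral_rpow_enorm_toReal hα' (by simp), ENNReal.toReal_ofReal hα.le]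
  congr 1
  rw [ratioLaw, lintegral_map (by fun_prop) (measurable_ratios f i₀), weight,
    lintegral_withDensity_eq_lintegral_mul _ (measurable_abs_rpow _).ennreal_ofReal
      (g := fun s => ‖φ (ratios f i₀ s)‖ₑ ^ α)
      ((hφ.enorm.pow_const α).comp (measurable_ratios f i₀))]
  refine lintegral_congr fun s => ?_
  rw [Pi.mul_apply, enorm_mul, ENNReal.mul_rpow_of_nonneg _ _ hα.le, mul_comm,
    ← ENNReal.ofReal_rpow_of_nonneg (abs_nonneg _) hα.le, Real.enorm_eq_ofReal_abs (f i₀ s)]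

/-- `h` and `k` are the same function of the ratios of `f` and of `g`. -/
def Corr (f : ι → LAlpha α μ₁) (g : ι → LAlpha α μ₂) (i₀ : ι) (h : LAlpha α μ₁)
    (k : LAlpha α μ₂) : Prop :=
  ∃ φ, RatioRep f i₀ φ h ∧ RatioRep g i₀ φ k

section Corr

variable {f : ι → LAlpha α μ₁} {g : ι → LAlpha α μ₂} {i₀ : ι} {h h' : LAlpha α μ₁}
  {k k' : LAlpha α μ₂}

lemma Corr.norm_eq (hα : 0 < α) (hlaw : ratioLaw f i₀ = ratioLaw g i₀) (H : Corr f g i₀ h k) :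
    ‖k‖ = ‖h‖ := by
  obtain ⟨φ, h1, h2⟩ := H
  rw [Lp.norm_def, Lp.norm_def, eLpNorm_congr_ae h1.2, eLpNorm_congr_ae h2.2,
    eLpNorm_comp_ratios hα f i₀ h1.1, eLpNorm_comp_ratios hα g i₀ h1.1, hlaw]

lemma RatioRep.exists_ratioRep (hα : 0 < α) (hlaw : ratioLaw f i₀ = ratioLaw g i₀)
    {φ : (ι → ℝ) → ℝ} (H : RatioRep f i₀ φ h) : ∃ k, RatioRep g i₀ φ k := by
  have hm : Measurable fun s => φ (ratios g i₀ s) * g i₀ s :=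
    (H.1.comp (measurable_ratios g i₀)).mul (measurable_coe _)
  have mem : MemLp (fun s => φ (ratios g i₀ s) * g i₀ s) (ENNReal.ofReal α) μ₂ := by
    refine ⟨hm.aestronglyMeasurable, ?_⟩
    rw [eLpNorm_comp_ratios hα g i₀ H.1, ← hlaw, ← eLpNorm_comp_ratios hα f i₀ H.1,
      ← eLpNorm_congr_ae H.2]
    exact Lp.eLpNorm_lt_top h
  exact ⟨mem.toLp _, H.1, mem.coeFn_toLp⟩

lemma RatioRep.comb {f : ι → LAlpha α μ} {h h' : LAlpha α μ} {φ ψ : (ι → ℝ) → ℝ}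
    (H : RatioRep f i₀ φ h) (H' : RatioRep f i₀ ψ h') (a b : ℝ) :
    RatioRep f i₀ (fun x => a * φ x + b * ψ x) (a • h + b • h') := by
  refine ⟨(H.1.const_mul a).add (H'.1.const_mul b), ?_⟩
  filter_upwards [H.2, H'.2, Lp.coeFn_add (a • h) (b • h'), Lp.coeFn_smul a h,
    Lp.coeFn_smul b h'] with s h1 h2 h3 h4 h5
  rw [h3, Pi.add_apply, h4, h5, Pi.smul_apply, Pi.smul_apply, h1, h2, smul_eq_mul, smul_eq_mul]
  ring

lemma RatioRep.sup {f : ι → LAlpha α μ} {h h' : LAlpha α μ} {φ ψ : (ι → ℝ) → ℝ}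
    (hf₀ : 0 ≤ f i₀) (H : RatioRep f i₀ φ h) (H' : RatioRep f i₀ ψ h') (a b : ℝ) :
    RatioRep f i₀ (fun x => max (a * φ x) (b * ψ x)) ((a • h) ⊔ (b • h')) := by
  refine ⟨(H.1.const_mul a).max (H'.1.const_mul b), ?_⟩
  filter_upwards [H.2, H'.2, Lp.coeFn_sup (a • h) (b • h'), Lp.coeFn_smul a h,
    Lp.coeFn_smul b h', coeFn_nonneg hf₀] with s h1 h2 h3 h4 h5 h6
  rw [h3, Pi.sup_apply, h4, h5, Pi.smul_apply, Pi.smul_apply, h1, h2, smul_eq_mul, smul_eq_mul,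
    max_mul_of_nonneg _ _ h6, mul_assoc, mul_assoc]

lemma Corr.comb (H : Corr f g i₀ h k) (H' : Corr f g i₀ h' k') (a b : ℝ) :
    Corr f g i₀ (a • h + b • h') (a • k + b • k') := by
  obtain ⟨φ, h1, h2⟩ := H
  obtain ⟨ψ, h3, h4⟩ := H'
  exact ⟨_, h1.comb h3 a b, h2.comb h4 a b⟩

lemma Corr.sup (hf₀ : 0 ≤ f i₀) (hg₀ : 0 ≤ g i₀) (H : Corr f g i₀ h k) (H' : Corr f g i₀ h' k')
    (a b : ℝ) : Corr f g i₀ ((a • h) ⊔ (b • h')) ((a • k) ⊔ (b • k')) := by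
  obtain ⟨φ, h1, h2⟩ := H
  obtain ⟨ψ, h3, h4⟩ := H'
  exact ⟨_, h1.sup hf₀ h3 a b, h2.sup hg₀ h4 a b⟩

lemma Corr.norm_sub_eq (hα : 0 < α) (hlaw : ratioLaw f i₀ = ratioLaw g i₀)
    (H : Corr f g i₀ h k) (H' : Corr f g i₀ h' k') : ‖k - k'‖ = ‖h - h'‖ := by
  have := (H.comb H' 1 (-1)).norm_eq hα hlaw
  simpa [sub_eq_add_neg] using this

/-- The representing `φ` need not be unique, but two images of the same `h` differ by an element of
norm `‖h - h‖ = 0`. -/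
lemma Corr.unique (hα : 0 < α) (hlaw : ratioLaw f i₀ = ratioLaw g i₀)
    (H : Corr f g i₀ h k) (H' : Corr f g i₀ h k') : k = k' := by
  have := H.norm_sub_eq hα hlaw H'
  rw [sub_self, Lp.norm_zero, Lp.norm_eq_zero_iff (by simpa using hα)] at this
  exact sub_eq_zero.1 this

lemma Corr.nonneg (hα : 0 < α) (hlaw : ratioLaw f i₀ = ratioLaw g i₀) (hf₀ : 0 ≤ f i₀)
    (hg₀ : 0 ≤ g i₀) (H : Corr f g i₀ h k) (hh : 0 ≤ h) : 0 ≤ k := by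
  -- Nonnegativity is the lattice identity `h ⊔ 0 = h`, which the correspondence preserves.
  have e := H.sup hf₀ hg₀ H 1 0
  rw [one_smul, one_smul, zero_smul, zero_smul, sup_eq_left.2 hh] at e
  exact sup_eq_left.1 (e.unique hα hlaw H)

lemma extendedRatioSpace_comb_mem {f : ι → LAlpha α μ} {h h' : LAlpha α μ} (hf₀ : 0 ≤ f i₀)
    (hf : FullSupport f i₀)
    (hh : h ∈ extendedRatioSpace (range f)) (hh' : h' ∈ extendedRatioSpace (range f)) (a b : ℝ) :
    a • h + b • h' ∈ extendedRatioSpace (range f) := by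
  obtain ⟨φ, h1⟩ := (mem_extendedRatioSpace_range_iff hf₀ hf).1 hh
  obtain ⟨ψ, h2⟩ := (mem_extendedRatioSpace_range_iff hf₀ hf).1 hh'
  exact (mem_extendedRatioSpace_range_iff hf₀ hf).2 ⟨_, h1.comb h2 a b⟩

lemma smul_nonneg_coe {h : LAlpha α μ} (hh : 0 ≤ h) {a : ℝ} (ha : 0 ≤ a) : 0 ≤ a • h := by
  rw [← Lp.coeFn_nonneg]
  filter_upwards [coeFn_nonneg hh, Lp.coeFn_smul a h] with s h1 h2
  rw [h2]
  exact mul_nonneg ha h1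

lemma extendedPosRatioSpace_sup_mem {f : ι → LAlpha α μ} {h h' : LAlpha α μ} (hf₀ : 0 ≤ f i₀)
    (hf : FullSupport f i₀)
    (hh : h ∈ extendedPosRatioSpace (range f)) (hh' : h' ∈ extendedPosRatioSpace (range f))
    {a : ℝ} (ha : 0 ≤ a) (b : ℝ) :
    (a • h) ⊔ (b • h') ∈ extendedPosRatioSpace (range f) := by
  rw [mem_extendedPosRatioSpace_range_iff hf₀ hf] at hh hh' ⊢
  obtain ⟨φ, h1⟩ := (mem_extendedRatioSpace_range_iff hf₀ hf).1 hh.2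
  obtain ⟨ψ, h2⟩ := (mem_extendedRatioSpace_range_iff hf₀ hf).1 hh'.2
  exact ⟨le_sup_of_le_left (smul_nonneg_coe hh.1 ha),
    (mem_extendedRatioSpace_range_iff hf₀ hf).2 ⟨_, h1.sup hf₀ h2 a b⟩⟩

lemma exists_extension (hα : 0 < α) (hlaw : ratioLaw f i₀ = ratioLaw g i₀)
    (hf₀ : 0 ≤ f i₀) (hf : FullSupport f i₀) :
    ∃ V : LAlpha α μ₁ → LAlpha α μ₂, ∀ h ∈ extendedRatioSpace (range f), Corr f g i₀ h (V h) := by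
  have : ∀ h, ∃ k, h ∈ extendedRatioSpace (range f) → Corr f g i₀ h k := fun h => by
    by_cases hh : h ∈ extendedRatioSpace (range f)
    · obtain ⟨φ, h1⟩ := (mem_extendedRatioSpace_range_iff hf₀ hf).1 hh
      obtain ⟨k, hk⟩ := h1.exists_ratioRep hα hlaw
      exact ⟨k, fun _ => ⟨φ, h1, hk⟩⟩
    · exact ⟨0, fun h => absurd h hh⟩
  choose V hV using this
  exact ⟨V, hV⟩

variable {V : LAlpha α μ₁ → LAlpha α μ₂}

lemma isPositiveLinearIsometryOn_of_corr (hα : 0 < α) (hlaw : ratioLaw f i₀ = ratioLaw g i₀)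
    (hf₀ : 0 ≤ f i₀) (hg₀ : 0 ≤ g i₀)
    (hV : ∀ h ∈ extendedRatioSpace (range f), Corr f g i₀ h (V h)) :
    IsPositiveLinearIsometryOn V (extendedRatioSpace (range f)) where
  map_comb h hh h' hh' a b hc := (hV _ hc).unique hα hlaw ((hV h hh).comb (hV h' hh') a b)
  isometry h hh h' hh' := (hV h hh).norm_sub_eq hα hlaw (hV h' hh')
  map_nonneg h hh h0 := (hV h hh).nonneg hα hlaw hf₀ hg₀ h0

lemma mapsTo_extendedRatioSpace_of_corr (hg₀ : 0 ≤ g i₀) (hg : FullSupport g i₀)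
    (hV : ∀ h ∈ extendedRatioSpace (range f), Corr f g i₀ h (V h)) :
    MapsTo V (extendedRatioSpace (range f)) (extendedRatioSpace (range g)) := fun h hh => by
  obtain ⟨φ, -, h2⟩ := hV h hh
  exact (mem_extendedRatioSpace_range_iff hg₀ hg).2 ⟨φ, h2⟩

lemma isMaxLinearIsometryOn_of_corr (hα : 0 < α) (hlaw : ratioLaw f i₀ = ratioLaw g i₀)
    (hf₀ : 0 ≤ f i₀) (hg₀ : 0 ≤ g i₀) (hf : FullSupport f i₀)
    (hV : ∀ h ∈ extendedRatioSpace (range f), Corr f g i₀ h (V h)) :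
    IsMaxLinearIsometryOn V (extendedPosRatioSpace (range f)) where
  nonneg h hh := by
    rw [mem_extendedPosRatioSpace_range_iff hf₀ hf] at hh
    exact (hV h hh.2).nonneg hα hlaw hf₀ hg₀ hh.1
  map_sup h hh h' hh' a b ha _ := by
    have hs := extendedPosRatioSpace_sup_mem hf₀ hf hh hh' ha b
    rw [mem_extendedPosRatioSpace_range_iff hf₀ hf] at hh hh' hs
    exact (hV _ hs.2).unique hα hlaw ((hV h hh.2).sup hf₀ hg₀ (hV h' hh'.2) a b)
  norm_map h hh := by
    rw [mem_extendedPosRatioSpace_range_iff hf₀ hf] at hh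
    exact (hV h hh.2).norm_eq hα hlaw

lemma mapsTo_extendedPosRatioSpace_of_corr (hα : 0 < α) (hlaw : ratioLaw f i₀ = ratioLaw g i₀)
    (hf₀ : 0 ≤ f i₀) (hg₀ : 0 ≤ g i₀) (hf : FullSupport f i₀) (hg : FullSupport g i₀)
    (hV : ∀ h ∈ extendedRatioSpace (range f), Corr f g i₀ h (V h)) :
    MapsTo V (extendedPosRatioSpace (range f)) (extendedPosRatioSpace (range g)) := fun h hh => by
  rw [mem_extendedPosRatioSpace_range_iff hf₀ hf] at hh
  exact (mem_extendedPosRatioSpace_range_iff hg₀ hg).2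
    ⟨(hV h hh.2).nonneg hα hlaw hf₀ hg₀ hh.1,
      mapsTo_extendedRatioSpace_of_corr hg₀ hg hV hh.2⟩

lemma mem_extendedRatioSpace_self (hf₀ : 0 ≤ f i₀) (hf : FullSupport f i₀) (i : ι) :
    f i ∈ extendedRatioSpace (range f) :=
  (mem_extendedRatioSpace_range_iff hf₀ hf).2 ⟨_, ratioRep_eval hf i⟩

lemma apply_eq_of_corr (hα : 0 < α) (hlaw : ratioLaw f i₀ = ratioLaw g i₀)
    (hf₀ : 0 ≤ f i₀) (hf : FullSupport f i₀) (hg : FullSupport g i₀)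
    (hV : ∀ h ∈ extendedRatioSpace (range f), Corr f g i₀ h (V h)) (i : ι) : V (f i) = g i :=
  (hV _ (mem_extendedRatioSpace_self hf₀ hf i)).unique hα hlaw
    ⟨_, ratioRep_eval hf i, ratioRep_eval hg i⟩

/-- Equality of the laws of the ratios transfers full support. -/
lemma FullSupport.transfer (hα : 0 < α) (hlaw : ratioLaw f i₀ = ratioLaw g i₀)
    (hf : FullSupport f i₀) (hnorm : ∀ i, ‖f i‖ = ‖g i‖) : FullSupport g i₀ := by
  intro i
  -- `k` is `g i` cut down to the support of `g i₀`. It has the norm of `g i`, so nothing was lost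
  -- by cutting.
  obtain ⟨k, hk⟩ := (ratioRep_eval hf i).exists_ratioRep hα hlaw
  have e : ‖k‖ = ‖g i‖ := (Corr.norm_eq hα hlaw ⟨_, ratioRep_eval hf i, hk⟩).trans (hnorm i)
  rw [norm_eq_norm_iff hα, integral_eq_iff_of_ae_le (integrable_abs_rpow hα k)
    (integrable_abs_rpow hα (g i))] at e
  · filter_upwards [e, hk.2] with s h1 h2 h0
    rw [h2, h0, mul_zero, abs_zero, Real.zero_rpow hα.ne'] at h1
    by_contra hne
    exact (Real.rpow_pos_of_pos (abs_pos.2 hne) α).ne h1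
  · filter_upwards [hk.2] with s h1
    refine Real.rpow_le_rpow (abs_nonneg _) ?_ hα.le
    rw [h1]
    by_cases h0 : g i₀ s = 0
    · rw [h0, mul_zero, abs_zero]; exact abs_nonneg _
    · rw [ratios, div_mul_cancel₀ _ h0]

end Corr

/-! ### Uniqueness of extensions -/

lemma FullSupport.option {f : Option ι → LAlpha α μ} {i₀ : ι}
    (hf₀ : 0 ≤ f (some i₀)) (hf : FullSupport (fun i => f (some i)) i₀)
    (h : f none ∈ extendedRatioSpace (range fun i => f (some i))) :
    FullSupport f (some i₀) := by
  rintro (_ | i)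
  · obtain ⟨φ, hφ⟩ := (mem_extendedRatioSpace_range_iff (f := fun i => f (some i)) hf₀ hf).1 h
    filter_upwards [hφ.2] with s h1 h2
    rw [h1]
    exact mul_eq_zero_of_right _ h2
  · exact hf i

/-- Both `g none` and `k` correspond to `f none` for the enlarged families: one through the
coordinate `none`, the other through `φ` of the remaining coordinates. Equal laws make the image
unique. -/
lemma Corr.eq_of_option (hα : 0 < α) {f : Option ι → LAlpha α μ₁} {g : Option ι → LAlpha α μ₂}
    {i₀ : ι} (hlaw : ratioLaw f (some i₀) = ratioLaw g (some i₀))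
    (hf : FullSupport f (some i₀)) (hg : FullSupport g (some i₀)) {k : LAlpha α μ₂}
    (H : Corr (fun i => f (some i)) (fun i => g (some i)) i₀ (f none) k) : g none = k := by
  refine Corr.unique hα hlaw ⟨_, ratioRep_eval hf none, ratioRep_eval hg none⟩ ?_
  obtain ⟨φ, h1, h2⟩ := H
  have hm : Measurable fun x : Option ι → ℝ => fun i => x (some i) :=
    measurable_pi_lambda _ fun i => measurable_pi_apply _
  exact ⟨fun x => φ fun i => x (some i), ⟨h1.1.comp hm, h1.2⟩, ⟨h2.1.comp hm, h2.2⟩⟩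

/-! ### Positive-linear and max-linear spaces -/

/-- The multiples `f / (n + 1)` converge to zero for `rho`. -/
lemma zero_mem_of_isRhoClosed (hα : 0 < α) {F : Set (LAlpha α μ)} (hne : F.Nonempty)
    (hpos : ∀ f ∈ F, 0 ≤ f) (hcl : IsRhoClosed α μ F)
    (hsmul : ∀ f ∈ F, ∀ a : ℝ, 0 < a → a • f ∈ F) : 0 ∈ F := by
  obtain ⟨f, hf⟩ := hne
  refine hcl (fun n => (1 / ((n : ℝ) + 1)) • f) 0
    (fun n => hsmul f hf _ (by positivity)) le_rfl ?_
  have e : ∀ n : ℕ, rho α μ ((1 / ((n : ℝ) + 1)) • f) 0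
      = (1 / ((n : ℝ) + 1)) ^ α * ∫ s, |f s| ^ α ∂μ := fun n => by
    rw [rho, ← integral_const_mul]
    refine integral_congr_ae ?_
    filter_upwards [Lp.coeFn_smul (1 / ((n : ℝ) + 1)) f, Lp.coeFn_zero ℝ (ENNReal.ofReal α) μ,
      coeFn_nonneg (hpos f hf)] with s h1 h2 h3
    have h4 : (0 : ℝ) ≤ 1 / ((n : ℝ) + 1) := by positivity
    rw [h1, h2, Pi.smul_apply, Pi.zero_apply, Real.zero_rpow hα.ne', sub_zero, smul_eq_mul,
      Real.mul_rpow h4 h3, abs_of_nonneg h3, abs_of_nonneg (by positivity)]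
  simp_rw [e]
  have := ((tendsto_one_div_add_atTop_nhds_zero_nat (𝕜 := ℝ)).rpow_const
    (p := α) (Or.inr hα.le)).mul_const (∫ s, |f s| ^ α ∂μ)
  simpa [Real.zero_rpow hα.ne'] using this

lemma IsPositiveLinearSpace.smul_mem {F : Set (LAlpha α μ)} (hF : IsPositiveLinearSpace α μ F)
    {f : LAlpha α μ} (hf : f ∈ F) {a : ℝ} (ha : 0 < a) : a • f ∈ F := by
  have := hF.add_mem f hf f hf (a / 2) (a / 2) (half_pos ha) (half_pos ha)
  rwa [← add_smul, add_halves] at this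

lemma IsPositiveLinearSpace.zero_mem (hα : 0 < α) {F : Set (LAlpha α μ)}
    (hF : IsPositiveLinearSpace α μ F) (hne : F.Nonempty) : 0 ∈ F :=
  zero_mem_of_isRhoClosed hα hne hF.nonneg hF.closed fun _ hf _ ha => hF.smul_mem hf ha

lemma IsPositiveLinearSpace.smul_mem' (hα : 0 < α) {F : Set (LAlpha α μ)}
    (hF : IsPositiveLinearSpace α μ F) {f : LAlpha α μ} (hf : f ∈ F) {a : ℝ} (ha : 0 ≤ a) :
    a • f ∈ F := by
  rcases ha.eq_or_lt with rfl | ha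
  · rw [zero_smul]; exact hF.zero_mem hα ⟨f, hf⟩
  · exact hF.smul_mem hf ha

lemma IsPositiveLinearSpace.add_mem' {F : Set (LAlpha α μ)}
    (hF : IsPositiveLinearSpace α μ F) {f g : LAlpha α μ} (hf : f ∈ F) (hg : g ∈ F) :
    f + g ∈ F := by
  simpa using hF.add_mem f hf g hg 1 1 one_pos one_pos

lemma IsMaxLinearSpace.smul_mem {F : Set (LAlpha α μ)} (hF : IsMaxLinearSpace α μ F)
    {f : LAlpha α μ} (hf : f ∈ F) {a : ℝ} (ha : 0 < a) : a • f ∈ F := by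
  simpa using hF.sup_mem f hf f hf a a ha ha

lemma IsMaxLinearSpace.sup_mem' {F : Set (LAlpha α μ)}
    (hF : IsMaxLinearSpace α μ F) {f g : LAlpha α μ} (hf : f ∈ F) (hg : g ∈ F) :
    f ⊔ g ∈ F := by
  simpa using hF.sup_mem f hf g hg 1 1 one_pos one_pos

section Bounds

variable {f g : LAlpha α μ}

lemma le_add_of_nonneg_coe (f : LAlpha α μ) (hg : 0 ≤ g) : f ≤ f + g := by
  rw [← Lp.coeFn_le]
  filter_upwards [coeFn_nonneg hg, Lp.coeFn_add f g] with s h1 h2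
  rw [h2, Pi.add_apply]
  linarith

lemma sup_le_add_of_nonneg_coe (hf : 0 ≤ f) (hg : 0 ≤ g) : f ⊔ g ≤ f + g :=
  sup_le (le_add_of_nonneg_coe f hg) (by rw [add_comm]; exact le_add_of_nonneg_coe g hf)

end Bounds

lemma IsPositiveLinearSpace.exists_full_support [SigmaFinite μ] (hα : 0 < α)
    {F : Set (LAlpha α μ)} (hF : IsPositiveLinearSpace α μ F) (hne : F.Nonempty) :
    ∃ i₀ : F, FullSupport (fun f : F => (f : LAlpha α μ)) i₀ := by
  obtain ⟨f₀, hf₀, h⟩ := LAlpha.exists_full_support hα hne hF.nonneg hF.closed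
    fun f hf g hg c hc => by
      have hcg := smul_nonneg_coe (hF.nonneg g hg) hc.le
      exact ⟨f + c • g, hF.add_mem' hf (hF.smul_mem hg hc), le_add_of_nonneg_coe f hcg,
        by rw [add_comm]; exact le_add_of_nonneg_coe _ (hF.nonneg f hf), le_rfl⟩
  exact ⟨⟨f₀, hf₀⟩, fun f => h f f.2⟩

lemma IsMaxLinearSpace.exists_full_support [SigmaFinite μ] (hα : 0 < α)
    {F : Set (LAlpha α μ)} (hF : IsMaxLinearSpace α μ F) (hne : F.Nonempty) :
    ∃ i₀ : F, FullSupport (fun f : F => (f : LAlpha α μ)) i₀ := by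
  obtain ⟨f₀, hf₀, h⟩ := LAlpha.exists_full_support hα hne hF.nonneg hF.closed
    fun f hf g hg c hc => by
      have hcg := smul_nonneg_coe (hF.nonneg g hg) hc.le
      exact ⟨f ⊔ c • g, hF.sup_mem' hf (hF.smul_mem hg hc), le_sup_left, le_sup_right,
        sup_le_add_of_nonneg_coe (hF.nonneg f hf) hcg⟩
  exact ⟨⟨f₀, hf₀⟩, fun f => h f f.2⟩

/-! ### Isometries preserve the data that determine the ratio law -/

section Isometries

variable {U : LAlpha α μ₁ → LAlpha α μ₂} {F E : Set (LAlpha α μ₁)}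

lemma IsLinearIsometryOn.map_zero (hU : IsLinearIsometryOn U E) (h0 : 0 ∈ E) : U 0 = 0 := by
  simpa using hU.map_comb 0 h0 0 h0 0 0 (by simpa using h0)

lemma IsLinearIsometryOn.norm_map (hU : IsLinearIsometryOn U E) (h0 : 0 ∈ E)
    {h : LAlpha α μ₁} (hh : h ∈ E) : ‖U h‖ = ‖h‖ := by
  simpa [hU.map_zero h0] using hU.isometry h hh 0 h0

lemma IsLinearIsometryOn.map_add (hU : IsLinearIsometryOn U E)
    {h k : LAlpha α μ₁} (hh : h ∈ E) (hk : k ∈ E) (hhk : h + k ∈ E) : U (h + k) = U h + U k := by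
  simpa using hU.map_comb h hh k hk 1 1 (by simpa using hhk)

lemma IsLinearIsometryOn.map_smul (hU : IsLinearIsometryOn U E)
    {h : LAlpha α μ₁} (hh : h ∈ E) {a : ℝ} (ha : a • h ∈ E) : U (a • h) = a • U h := by
  simpa using hU.map_comb h hh h hh a 0 (by simpa using ha)

/-- A linear isometry on a positive-linear space preserves norms of real linear combinations. -/
lemma IsLinearIsometryOn.norm_linearCombination_of_isPositiveLinearSpace (hα : 0 < α)
    (hF : IsPositiveLinearSpace α μ₁ F) (hU : IsLinearIsometryOn U F) (hne : F.Nonempty)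
    (f : ι → LAlpha α μ₁) (hf : ∀ i, f i ∈ F) (a : ι →₀ ℝ) :
    ‖Finsupp.linearCombination ℝ f a‖ = ‖Finsupp.linearCombination ℝ (fun i => U (f i)) a‖ := by
  have h0 := hF.zero_mem hα hne
  -- Sorting the coefficients by sign writes the combination as a difference of two elements of `F`,
  -- where the isometry hypothesis applies directly.
  obtain ⟨p, hp, q, hq, e1, e2⟩ : ∃ p ∈ F, ∃ q ∈ F, Finsupp.linearCombination ℝ f a = p - q ∧
      Finsupp.linearCombination ℝ (fun i => U (f i)) a = U p - U q := by
    induction a using Finsupp.induction_linear with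
    | zero => exact ⟨0, h0, 0, h0, by simp, by simp⟩
    | add a b ha hb =>
      obtain ⟨p, hp, q, hq, e1, e2⟩ := ha
      obtain ⟨p', hp', q', hq', e1', e2'⟩ := hb
      refine ⟨p + p', hF.add_mem' hp hp', q + q', hF.add_mem' hq hq', ?_, ?_⟩
      · rw [_root_.map_add, e1, e1']; abel
      · rw [_root_.map_add, e2, e2', hU.map_add hp hp' (hF.add_mem' hp hp'),
          hU.map_add hq hq' (hF.add_mem' hq hq')]; abel
    | single i c =>
      simp only [Finsupp.linearCombination_single]
      rcases le_total 0 c with hc | hc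
      · have hm := hF.smul_mem' hα (hf i) hc
        exact ⟨c • f i, hm, 0, h0, by simp, by
          rw [hU.map_smul (hf i) hm, hU.map_zero h0, sub_zero]⟩
      · have hm := hF.smul_mem' hα (hf i) (neg_nonneg.2 hc)
        exact ⟨0, h0, (-c) • f i, hm, by simp, by
          rw [hU.map_smul (hf i) hm, hU.map_zero h0]; simp⟩
  rw [e1, e2, hU.isometry p hp q hq]

lemma IsLinearIsometryOn.norm_linearCombination (hU : IsLinearIsometryOn U E)
    (hE : ∀ h ∈ E, ∀ k ∈ E, ∀ a b : ℝ, a • h + b • k ∈ E) (h0 : 0 ∈ E)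
    (f : ι → LAlpha α μ₁) (hf : ∀ i, f i ∈ E) (a : ι →₀ ℝ) :
    ‖Finsupp.linearCombination ℝ f a‖ = ‖Finsupp.linearCombination ℝ (fun i => U (f i)) a‖ := by
  have hadd : ∀ {h k}, h ∈ E → k ∈ E → h + k ∈ E := fun hh hk => by
    simpa using hE _ hh _ hk 1 1
  have hsmul : ∀ {h} (c : ℝ), h ∈ E → c • h ∈ E := fun c hh => by
    simpa using hE _ hh _ hh c 0
  obtain ⟨h1, h2⟩ : Finsupp.linearCombination ℝ f a ∈ E ∧
      Finsupp.linearCombination ℝ (fun i => U (f i)) a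
        = U (Finsupp.linearCombination ℝ f a) := by
    induction a using Finsupp.induction_linear with
    | zero => exact ⟨by simpa using h0, by simp [hU.map_zero h0]⟩
    | add a b ha hb =>
      rw [_root_.map_add, _root_.map_add, ha.2, hb.2,
        hU.map_add ha.1 hb.1 (hadd ha.1 hb.1)]
      exact ⟨hadd ha.1 hb.1, rfl⟩
    | single i c =>
      simp only [Finsupp.linearCombination_single]
      exact ⟨hsmul c (hf i), (hU.map_smul (hf i) (hsmul c (hf i))).symm⟩
  rw [h2, hU.norm_map h0 h1]

/-- A max-linear isometry preserves the joint law of ratios. -/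
lemma IsMaxLinearIsometryOn.ratioLaw_eq (hα : 0 < α) (hU : IsMaxLinearIsometryOn U E)
    (hE0 : ∀ h ∈ E, 0 ≤ h) (hsup : ∀ h ∈ E, ∀ k ∈ E, h ⊔ k ∈ E)
    (hsmul : ∀ h ∈ E, ∀ a : ℝ, 0 < a → a • h ∈ E)
    (f : ι → LAlpha α μ₁) (hf : ∀ i, f i ∈ E) (i₀ : ι) :
    ratioLaw f i₀ = ratioLaw (fun i => U (f i)) i₀ := by
  -- The graph of `U` over `E` is stable under maxima and positive multiples, carrying membership in
  -- `E` along.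
  refine ratioLaw_eq_of_max hα (fun h k => h ∈ E ∧ k = U h) ?_ ?_ ?_ ?_ (fun i => ⟨hf i, rfl⟩) i₀
  · rintro h _ ⟨hh, rfl⟩
    exact (hU.norm_map h hh).symm
  · rintro h _ ⟨hh, rfl⟩
    exact ⟨hE0 h hh, hU.nonneg h hh⟩
  · rintro h _ h' _ ⟨hh, rfl⟩ ⟨hh', rfl⟩
    refine ⟨hsup h hh h' hh', ?_⟩
    simpa using (hU.map_sup h hh h' hh' 1 1 zero_le_one zero_le_one).symm
  · rintro h _ ⟨hh, rfl⟩ a ha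
    refine ⟨hsmul h hh a ha, ?_⟩
    simpa using (hU.map_sup h hh h hh a a ha.le ha.le).symm

end Isometries

lemma notMem_extendedRatioSpace_empty (h : LAlpha α μ₁) :
    h ∉ extendedRatioSpace (∅ : Set (LAlpha α μ₁)) := by
  rintro ⟨_, _, _, hf, _⟩
  exact hf

lemma extendedPosRatioSpace_subset (F : Set (LAlpha α μ₁)) :
    extendedPosRatioSpace F ⊆ extendedRatioSpace F := by
  rintro h ⟨-, r, hr, -, hh⟩
  exact ⟨r, hr, hh⟩

lemma option_elim_comp {V : LAlpha α μ₁ → LAlpha α μ₂} {f : ι → LAlpha α μ₁}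
    {g : ι → LAlpha α μ₂} (hV : ∀ i, V (f i) = g i) (h : LAlpha α μ₁) :
    (fun o : Option ι => V (o.elim h f)) = fun o => o.elim (V h) g := by
  ext1 (_ | i)
  · rfl
  · exact hV i

/-- The extended ratio space is linear, so `V` preserves norms of combinations of `h` and the `f i`,
and the enlarged families share a ratio law. The assumption on the range of `V` gives full support
on the image side. -/
lemma IsLinearIsometryOn.eq_of_corr (hα : 0 < α) (hα2 : α < 2) {f : ι → LAlpha α μ₁}
    {g : ι → LAlpha α μ₂} {i₀ : ι} (hf₀ : 0 ≤ f i₀) (hg₀ : 0 ≤ g i₀) (hf : FullSupport f i₀)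
    (hg : FullSupport g i₀) {V : LAlpha α μ₁ → LAlpha α μ₂}
    (hV : IsLinearIsometryOn V (extendedRatioSpace (range f)))
    (hmaps : MapsTo V (extendedRatioSpace (range f)) (extendedRatioSpace (range g)))
    (hVf : ∀ i, V (f i) = g i) {h : LAlpha α μ₁} (hh : h ∈ extendedRatioSpace (range f))
    {k : LAlpha α μ₂} (H : Corr f g i₀ h k) : V h = k := by
  refine Corr.eq_of_option hα (f := fun o => o.elim h f) (g := fun o => o.elim (V h) g)
    (i₀ := i₀) ?_ (FullSupport.option hf₀ hf hh) (FullSupport.option hg₀ hg (hmaps hh)) H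
  refine ratioLaw_eq_of_norm_linearCombination hα hα2 _ fun a => ?_
  rw [← option_elim_comp hVf h]
  refine hV.norm_linearCombination
    (fun p hp q hq a b => extendedRatioSpace_comb_mem hf₀ hf hp hq a b) ?_ _ ?_ a
  · simpa using extendedRatioSpace_comb_mem hf₀ hf hh hh 0 0
  · rintro (_ | i)
    · exact hh
    · exact mem_extendedRatioSpace_self hf₀ hf i

lemma IsMaxLinearIsometryOn.eq_of_corr (hα : 0 < α) {f : ι → LAlpha α μ₁}
    {g : ι → LAlpha α μ₂} {i₀ : ι} (hfpos : ∀ i, 0 ≤ f i) (hg₀ : 0 ≤ g i₀)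
    (hf : FullSupport f i₀) (hg : FullSupport g i₀) {V : LAlpha α μ₁ → LAlpha α μ₂}
    (hV : IsMaxLinearIsometryOn V (extendedPosRatioSpace (range f)))
    (hmaps : MapsTo V (extendedPosRatioSpace (range f)) (extendedPosRatioSpace (range g)))
    (hVf : ∀ i, V (f i) = g i) {h : LAlpha α μ₁} (hh : h ∈ extendedPosRatioSpace (range f))
    {k : LAlpha α μ₂} (H : Corr f g i₀ h k) : V h = k := by
  have hf₀ := hfpos i₀
  refine Corr.eq_of_option hα (f := fun o => o.elim h f) (g := fun o => o.elim (V h) g)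
    (i₀ := i₀) ?_ (FullSupport.option hf₀ hf (extendedPosRatioSpace_subset _ hh))
    (FullSupport.option hg₀ hg (extendedPosRatioSpace_subset _ (hmaps hh))) H
  rw [← option_elim_comp hVf h]
  refine hV.ratioLaw_eq hα (fun p hp => hp.1) (fun p hp q hq => ?_) (fun p hp a ha => ?_) _ ?_ _
  · simpa using extendedPosRatioSpace_sup_mem hf₀ hf hp hq zero_le_one 1
  · simpa using extendedPosRatioSpace_sup_mem hf₀ hf hp hp ha.le a
  · rintro (_ | i)
    · exact hh
    · exact (mem_extendedPosRatioSpace_range_iff hf₀ hf).2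
        ⟨hfpos i, mem_extendedRatioSpace_self hf₀ hf i⟩

/-! ### The empty case and the two extension theorems -/

lemma isPositiveLinearIsometryOn_extendedRatioSpace_empty (U : LAlpha α μ₁ → LAlpha α μ₂) :
    IsPositiveLinearIsometryOn U (extendedRatioSpace ∅) where
  map_comb h hh := absurd hh (notMem_extendedRatioSpace_empty h)
  isometry h hh := absurd hh (notMem_extendedRatioSpace_empty h)
  map_nonneg h hh := absurd hh (notMem_extendedRatioSpace_empty h)

lemma extendedPosRatioSpace_empty : extendedPosRatioSpace (∅ : Set (LAlpha α μ₁)) = ∅ :=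
  eq_empty_of_forall_notMem fun h hh =>
    notMem_extendedRatioSpace_empty h (extendedPosRatioSpace_subset _ hh)

lemma isMaxLinearIsometryOn_extendedPosRatioSpace_empty (U : LAlpha α μ₁ → LAlpha α μ₂) :
    IsMaxLinearIsometryOn U (extendedPosRatioSpace ∅) := by
  rw [extendedPosRatioSpace_empty]
  exact ⟨fun h hh => hh.elim, fun h hh => hh.elim, fun h hh => hh.elim⟩

lemma mapsTo_extendedRatioSpace_empty (U : LAlpha α μ₁ → LAlpha α μ₂)
    (E : Set (LAlpha α μ₂)) : MapsTo U (extendedRatioSpace ∅) E :=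
  fun h hh => absurd hh (notMem_extendedRatioSpace_empty h)

lemma mapsTo_extendedPosRatioSpace_empty (U : LAlpha α μ₁ → LAlpha α μ₂)
    (E : Set (LAlpha α μ₂)) : MapsTo U (extendedPosRatioSpace ∅) E :=
  (mapsTo_extendedRatioSpace_empty U E).mono_left (extendedPosRatioSpace_subset _)

theorem IsPositiveLinearIsometryOn.exists_unique_extension
    [SigmaFinite μ₁] (hα : 0 < α) (hα2 : α < 2)
    {F : Set (LAlpha α μ₁)} {U : LAlpha α μ₁ → LAlpha α μ₂} (hF : IsPositiveLinearSpace α μ₁ F)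
    (hU : IsPositiveLinearIsometryOn U F) :
    ∃ Ubar : LAlpha α μ₁ → LAlpha α μ₂,
      IsLinearExtension F U Ubar ∧
      (∀ V : LAlpha α μ₁ → LAlpha α μ₂, IsLinearExtension F U V →
        EqOn V Ubar (extendedRatioSpace F)) ∧
      IsMaxLinearIsometryOn Ubar (extendedPosRatioSpace F) ∧
      MapsTo Ubar (extendedPosRatioSpace F)
        (extendedPosRatioSpace (U '' F)) := by
  rcases F.eq_empty_or_nonempty with rfl | hne
  · exact ⟨U, ⟨(isPositiveLinearIsometryOn_extendedRatioSpace_empty U).1,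
      mapsTo_extendedRatioSpace_empty U _, fun _ _ => rfl⟩,
      fun V _ h hh => absurd hh (notMem_extendedRatioSpace_empty h),
      isMaxLinearIsometryOn_extendedPosRatioSpace_empty U, mapsTo_extendedPosRatioSpace_empty U _⟩
  have hrf : range (fun x : F => (x : LAlpha α μ₁)) = F := Subtype.range_coe
  have hrg : range (fun x : F => U x) = U '' F := (image_eq_range U F).symm
  obtain ⟨i₀, hf⟩ := hF.exists_full_support hα hne
  have hf₀ : (0 : LAlpha α μ₁) ≤ i₀ := hF.nonneg i₀ i₀.2
  have hg₀ : 0 ≤ U i₀ := hU.map_nonneg i₀ i₀.2 hf₀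
  have hlaw : ratioLaw (fun x : F => (x : LAlpha α μ₁)) i₀ = ratioLaw (fun x : F => U x) i₀ :=
    ratioLaw_eq_of_norm_linearCombination hα hα2 i₀
      (hU.norm_linearCombination_of_isPositiveLinearSpace hα hF hne _ fun x => x.2)
  have hg := hf.transfer hα hlaw fun x =>
    (hU.norm_map (hF.zero_mem hα hne) x.2).symm
  obtain ⟨V, hV⟩ := exists_extension hα hlaw hf₀ hf
  have lin := isPositiveLinearIsometryOn_of_corr hα hlaw hf₀ hg₀ hV
  have maps := mapsTo_extendedRatioSpace_of_corr (g := fun x : F => U x) hg₀ hg hV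
  have sup := isMaxLinearIsometryOn_of_corr hα hlaw hf₀ hg₀ hf hV
  have maps' := mapsTo_extendedPosRatioSpace_of_corr hα hlaw hf₀ hg₀ hf hg hV
  have ext := apply_eq_of_corr hα hlaw hf₀ hf hg hV
  have uniq := fun (W : LAlpha α μ₁ → LAlpha α μ₂) hW hm hWf h hh =>
    IsLinearIsometryOn.eq_of_corr hα hα2 hf₀ hg₀ hf hg (V := W) hW hm hWf (h := h) hh (hV h hh)
  rw [hrf] at lin maps sup maps' uniq
  rw [hrg] at maps maps' uniq
  exact ⟨V, ⟨lin.1, maps, fun x hx => ext ⟨x, hx⟩⟩,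
    fun W hW h hh => uniq W hW.isom hW.mapsTo (fun x => hW.eqOn x.2) h hh, sup, maps'⟩

theorem IsMaxLinearIsometryOn.exists_unique_extension
    [SigmaFinite μ₁] (hα : 0 < α)
    {F : Set (LAlpha α μ₁)} {U : LAlpha α μ₁ → LAlpha α μ₂} (hF : IsMaxLinearSpace α μ₁ F)
    (hU : IsMaxLinearIsometryOn U F) :
    ∃ Ubar : LAlpha α μ₁ → LAlpha α μ₂,
      IsMaxLinearExtension F U Ubar ∧
      (∀ V : LAlpha α μ₁ → LAlpha α μ₂, IsMaxLinearExtension F U V →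
        EqOn V Ubar (extendedPosRatioSpace F)) ∧
      IsPositiveLinearIsometryOn Ubar (extendedRatioSpace F) ∧
      MapsTo Ubar (extendedRatioSpace F)
        (extendedRatioSpace (U '' F)) := by
  rcases F.eq_empty_or_nonempty with rfl | hne
  · exact ⟨U, ⟨isMaxLinearIsometryOn_extendedPosRatioSpace_empty U,
      mapsTo_extendedPosRatioSpace_empty U _, fun _ _ => rfl⟩,
      fun V _ h hh => absurd (extendedPosRatioSpace_subset _ hh)
        (notMem_extendedRatioSpace_empty h),
      isPositiveLinearIsometryOn_extendedRatioSpace_empty U, mapsTo_extendedRatioSpace_empty U _⟩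
  have hrf : range (fun x : F => (x : LAlpha α μ₁)) = F := Subtype.range_coe
  have hrg : range (fun x : F => U x) = U '' F := (image_eq_range U F).symm
  obtain ⟨i₀, hf⟩ := hF.exists_full_support hα hne
  have hfpos : ∀ x : F, (0 : LAlpha α μ₁) ≤ x := fun x => hF.nonneg x x.2
  have hf₀ := hfpos i₀
  have hg₀ : 0 ≤ U i₀ := hU.nonneg i₀ i₀.2
  have hlaw : ratioLaw (fun x : F => (x : LAlpha α μ₁)) i₀ = ratioLaw (fun x : F => U x) i₀ :=
    hU.ratioLaw_eq hα hF.nonneg (fun h hh k hk => hF.sup_mem' hh hk)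
      (fun h hh a ha => hF.smul_mem hh ha) _ (fun x => x.2) i₀
  have hg := hf.transfer hα hlaw fun x => (hU.norm_map x x.2).symm
  obtain ⟨V, hV⟩ := exists_extension hα hlaw hf₀ hf
  have lin := isPositiveLinearIsometryOn_of_corr hα hlaw hf₀ hg₀ hV
  have maps := mapsTo_extendedRatioSpace_of_corr (g := fun x : F => U x) hg₀ hg hV
  have sup := isMaxLinearIsometryOn_of_corr hα hlaw hf₀ hg₀ hf hV
  have maps' := mapsTo_extendedPosRatioSpace_of_corr hα hlaw hf₀ hg₀ hf hg hV
  have ext := apply_eq_of_corr hα hlaw hf₀ hf hg hV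
  have uniq := fun (W : LAlpha α μ₁ → LAlpha α μ₂) hW hm hWf h hh =>
    IsMaxLinearIsometryOn.eq_of_corr hα hfpos hg₀ hf hg (V := W) hW hm hWf (h := h) hh
      (hV h (extendedPosRatioSpace_subset _ hh))
  rw [hrf] at lin maps sup maps' uniq
  rw [hrg] at maps maps' uniq
  exact ⟨V, ⟨sup, maps', fun x hx => ext ⟨x, hx⟩⟩,
    fun W hW h hh => uniq W hW.isom hW.mapsTo (fun x => hW.eqOn x.2) h hh, lin, maps⟩

end LAlpha

end

theorem proposition2p1 {S₁ S₂ : Type*} [MeasurableSpace S₁] [MeasurableSpace S₂]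
    (μ₁ : Measure S₁) (μ₂ : Measure S₂) [SigmaFinite μ₁] [SigmaFinite μ₂]
    (α : ℝ) (hα : 0 < α) (hα2 : α < 2)
    (F : Set (LAlpha α μ₁)) (U : LAlpha α μ₁ → LAlpha α μ₂) :
    -- positive-linear `F`: the unique linear isometric extension is also a max-linear isometry
    (LAlpha.IsPositiveLinearSpace α μ₁ F → LAlpha.IsPositiveLinearIsometryOn U F →
      ∃ Ubar : LAlpha α μ₁ → LAlpha α μ₂,
        LAlpha.IsLinearExtension F U Ubar ∧
        (∀ V : LAlpha α μ₁ → LAlpha α μ₂, LAlpha.IsLinearExtension F U V →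
          EqOn V Ubar (LAlpha.extendedRatioSpace F)) ∧
        LAlpha.IsMaxLinearIsometryOn Ubar (LAlpha.extendedPosRatioSpace F) ∧
        MapsTo Ubar (LAlpha.extendedPosRatioSpace F)
          (LAlpha.extendedPosRatioSpace (U '' F))) ∧
    -- max-linear `F`: the unique max-linear isometric extension is also a positive-linear isometry
    (LAlpha.IsMaxLinearSpace α μ₁ F → LAlpha.IsMaxLinearIsometryOn U F →
      ∃ Ubar : LAlpha α μ₁ → LAlpha α μ₂,
        LAlpha.IsMaxLinearExtension F U Ubar ∧
        (∀ V : LAlpha α μ₁ → LAlpha α μ₂, LAlpha.IsMaxLinearExtension F U V →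
          EqOn V Ubar (LAlpha.extendedPosRatioSpace F)) ∧
        LAlpha.IsPositiveLinearIsometryOn Ubar (LAlpha.extendedRatioSpace F) ∧
        MapsTo Ubar (LAlpha.extendedRatioSpace F)
          (LAlpha.extendedRatioSpace (U '' F))) := by
  exact ⟨fun hF hU => hU.exists_unique_extension hα hα2 hF,
    fun hF hU => hU.exists_unique_extension hα hF⟩
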